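/- **Conventions.** On $\mathbb C^3$ put $g=\sum_j|dz_j|^2$ and $\Omega=dz_1\wedge dz_2\wedge dz_3$. An oriented real 3-dimensional subspace $V\subset\mathbb C^3$ is *special Lagrangian* if $\mathrm{Re}\,\Omega|_V=\mathrm{vol}_V$. A smooth map $F:M\to\mathbb C^3$ from a 3-manifold is a (possibly singular) *special Lagrangian 3-fold* if it is an immersion on a dense set of points (the nonsingular points), and the tangent planes at the nonsingular points admit a continuous choice of orientation for which they are all special Lagrangian. It is *r-oriented ruled* over a surface $\Sigma$ if there is a smooth map $\pi:M\to\Sigma$ such that $F$ maps each fibre of $\pi$ bijectively to a real affine straight line, each of these lines being oriented, continuously over $\Sigma$. **Setting.** Let $N_0=\{r\phi(\sigma):\sigma\in\Sigma,\ r\in\mathbb R\}$ be an r-oriented two-sided special Lagrangian cone in $\mathbb C^3$. That is, $\Sigma$ is a connected surface, $\phi:\Sigma\to\mathcal S^5\subset\mathbb C^3$ is a smooth immersion into the unit sphere, and $\Sigma\times\mathbb R\to\mathbb C^3$, $(\sigma,r)\mapsto r\phi(\sigma)$, is special Lagrangian (wherever it is an immersion). Give $\Sigma$ the metric $\phi^*g$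 and the orientation for which local coordinates $(s,t)$ are oriented if $\mathrm{Re}\,\Omega(\phi,\partial_s\phi,\partial_t\phi)>0$. These make $\Sigma$ into a Riemann surface, with Hodge star $*$ (so $*ds=dt$, $*dt=-ds$ for a holomorphic coordinate $s+it$). **Theorem.** Suppose in addition that $\Sigma$ is simply connected. Let $w$ be a holomorphic vector field on $\Sigma$, and let $\psi=\mathcal L_w\phi=d\phi(w):\Sigma\to\mathbb C^3$ be the Lie derivative of $\phi$ along $w$. Let $\rho:\Sigma\to\mathbb R$ be a smooth solution of $$*d(*d\rho)+2\rho=0,$$ and define a $\mathbb C^3$-valued 1-form on $\Sigma$ by $\beta=\phi\,{*d\rho}-\rho\,{*d\phi}$. Then: 1. $\beta$ is closed, and there exists $\mathbf b:\Sigma\to\mathbb C^3$ with $d\mathbf b=\beta$. 2. For every $\mathbf b:\Sigma\to\mathbb C^3$ with $d\mathbf b=\beta$, the set $$N=\{r\,\phi(\sigma)+\psi(\sigma)+\mathbf b(\sigma):\sigma\in\Sigma,\ r\in\mathbb R\},$$ parametrized by $(\sigma,r)\mapsto r\phi(\sigma)+\psi(\sigma)+\mathbf b(\sigma)$ on $\Sigma\times\mathbb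 R$, is an r-oriented ruled special Lagrangian 3-fold in $\mathbb C^3$, ruled by $(\sigma,r)\mapsto\sigma$, whose line over $\sigma$ has positive unit direction $\phi(\sigma)$. -/

import Mathlib

open scoped Manifold ContDiff Topology

noncomputable section

namespace RuledSL

/-! ### Special Lagrangian geometry in `ℂ³` -/

/-- `ℂ³`. Its real inner product is `g = |dz₁|² + |dz₂|² + |dz₃|²`. -/
abbrev C3 : Type := EuclideanSpace ℂ (Fin 3)

/-- The real `3`-form `Re Ω`, where `Ω = dz₁ ∧ dz₂ ∧ dz₃`. -/
def reOmega (v : Fin 3 → C3) : ℝ :=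
  (Matrix.det (Matrix.of fun i j : Fin 3 => v i j)).re

/-- The oriented real `3`-plane `(V, o)` is calibrated by `Re Ω`: the restriction of `Re Ω` to `V`
is the volume form of `V` determined by the induced metric and the orientation `o`. -/
def IsCalibratedPlane (V : Submodule ℝ C3) (o : Orientation ℝ V (Fin 3)) : Prop :=
  ∃ _ : Fact (Module.finrank ℝ V = 3),
    ∀ v : Fin 3 → V, reOmega (fun i => (v i : C3)) = o.volumeForm v

section Immersed

variable {E H M : Type*} [NormedAddCommGroup E] [NormedSpace ℝ E] [TopologicalSpace H]
  (I : ModelWithCorners ℝ E H) [TopologicalSpace M] [ChartedSpace H M]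

/-- The smooth map `F : M → ℂ³` is an immersion at `p`. -/
def IsImmersedAt (F : M → C3) (p : M) : Prop :=
  Function.Injective (mfderiv I 𝓘(ℝ, C3) F p)

/-- The image of the derivative of `F` at `p`; it is the tangent plane, as a real subspace
of `ℂ³`, of the immersed submanifold `F` if `F` is an immersion at `p`. -/
def tangentPlane (F : M → C3) (p : M) : Submodule ℝ C3 :=
  let D : TangentSpace I p →L[ℝ] C3 := mfderiv I 𝓘(ℝ, C3) F p
  LinearMap.range D.toLinearMap

/-- A family `o` of orientations of the tangent planes at the nonsingular points of `F` is
continuous: near every nonsingular point the tangent planes have a continuous oriented frame. -/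
def IsContinuousOrientation (F : M → C3)
    (o : ∀ p : M, IsImmersedAt I F p → Orientation ℝ (tangentPlane I F p) (Fin 3)) : Prop :=
  ∀ p : M, IsImmersedAt I F p → ∃ U ∈ 𝓝 p, ∃ X : Fin 3 → M → C3,
    (∀ i, ContinuousOn (X i) U) ∧
    ∀ q ∈ U, ∀ hq : IsImmersedAt I F q,
      ∃ B : Module.Basis (Fin 3) ℝ (tangentPlane I F q),
        (∀ i, (B i : C3) = X i q) ∧ B.orientation = o q hq

/-- The smooth map `F : M → ℂ³` is a (possibly singular) immersed special Lagrangian `3`-fold, of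
phase `1`: it is an immersion on a dense set, the set of nonsingular points, and on this set it has
an orientation for which it is calibrated by `Re Ω`. -/
structure IsSpecialLagrangian (F : M → C3) : Prop where
  smooth : ContMDiff I 𝓘(ℝ, C3) ∞ F
  dense_immersed : Dense {p : M | IsImmersedAt I F p}
  calibrated : ∃ o : ∀ p : M, IsImmersedAt I F p → Orientation ℝ (tangentPlane I F p) (Fin 3),
    IsContinuousOrientation I F o ∧ ∀ p hp, IsCalibratedPlane (tangentPlane I F p) (o p hp)

end Immersed

/-! ### Ruled submanifolds -/

section Ruled

variable {E H N E' H' S : Type*} [NormedAddCommGroup E] [NormedSpace ℝ E] [TopologicalSpace H]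
  (I : ModelWithCorners ℝ E H) [TopologicalSpace N] [ChartedSpace H N]
  [NormedAddCommGroup E'] [NormedSpace ℝ E'] [TopologicalSpace H']
  (I' : ModelWithCorners ℝ E' H') [TopologicalSpace S] [ChartedSpace H' S]

/-- `π : N → S` is an r-oriented ruling of the (possibly singular) immersed submanifold
`F : N → ℂ³`: the map `π` is smooth, and `F` maps every fibre of `π` bijectively onto a real affine
straight line. The line over `σ` is oriented by its unit vector `d σ`, which varies continuously. -/
structure IsROrientedRuling (F : N → C3) (π : N → S) (d : S → C3) : Prop where
  smooth_proj : ContMDiff I I' ∞ π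
  continuous_dir : Continuous d
  norm_dir : ∀ σ, ‖d σ‖ = 1
  fibre : ∀ σ, ∃ a : C3, Set.BijOn F (π ⁻¹' {σ}) (Set.range fun r : ℝ => a + r • d σ)

/-- `(N, S, π)`, with `N` immersed by `F`, is an r-oriented ruled special Lagrangian `3`-fold whose
lines have the positive unit direction vectors `d`. -/
structure IsROrientedRuledSL (F : N → C3) (π : N → S) (d : S → C3) : Prop where
  ruling : IsROrientedRuling I I' F π d
  specialLagrangian : IsSpecialLagrangian I F

end Ruled

/-! ### Calculus on a Riemann surface -/

section Surface

variable {S : Type*} [TopologicalSpace S] [ChartedSpace ℂ S]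

/-- The derivative of `f : S → F` as an `F`-valued `1`-form on the real surface `S`. -/
def diff {F : Type*} [NormedAddCommGroup F] [NormedSpace ℝ F] (f : S → F) (x : S) :
    TangentSpace 𝓘(ℝ, ℂ) x →L[ℝ] F :=
  mfderiv 𝓘(ℝ, ℂ) 𝓘(ℝ, F) f x

/-- The complex structure `J` of a Riemann surface, on its real tangent spaces. -/
def J (x : S) : TangentSpace 𝓘(ℝ, ℂ) x →L[ℝ] TangentSpace 𝓘(ℝ, ℂ) x :=
  (ContinuousLinearMap.mul ℝ ℂ Complex.I : ℂ →L[ℝ] ℂ)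

/-- The exterior derivative of a vector-valued `1`-form `α`: if `a` is the `1`-form on an open set of
`ℂ = ℝ²` that represents `α` in the preferred chart at `x` (which also identifies the tangent
space at `x` with `ℂ`), then `(dα)ₓ(v, w) = (∂ᵥ a)(w) - (∂_w a)(v)`. -/
def extD {F : Type*} [NormedAddCommGroup F] [NormedSpace ℝ F]
    (α : ∀ x : S, TangentSpace 𝓘(ℝ, ℂ) x →L[ℝ] F) (x : S) (v w : TangentSpace 𝓘(ℝ, ℂ) x) : F :=
  let a : ℂ → ℂ →L[ℝ] F := fun y =>
    (α ((extChartAt 𝓘(ℝ, ℂ) x).symm y)).comp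
      (mfderiv 𝓘(ℝ, ℂ) 𝓘(ℝ, ℂ) (extChartAt 𝓘(ℝ, ℂ) x).symm y)
  fderiv ℝ a (extChartAt 𝓘(ℝ, ℂ) x x) v w - fderiv ℝ a (extChartAt 𝓘(ℝ, ℂ) x x) w v

/-- The Hodge star on `1`-forms of an oriented Riemannian surface with complex structure `J`:
`*α = -α ∘ J`, that is `*ds = dt` and `*dt = -ds` in oriented conformal coordinates `(s, t)`. -/
def starOne {F : Type*} [NormedAddCommGroup F] [NormedSpace ℝ F]
    (α : ∀ x : S, TangentSpace 𝓘(ℝ, ℂ) x →L[ℝ] F) (x : S) : TangentSpace 𝓘(ℝ, ℂ) x →L[ℝ] F :=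
  -(α x).comp (J x)

/-- The metric on `S` induced by `φ : S → ℂ³`. -/
def inducedMetric (φ : S → C3) (x : S) (v w : TangentSpace 𝓘(ℝ, ℂ) x) : ℝ :=
  inner ℝ (diff φ x v) (diff φ x w)

/-- The area form `(v, w) ↦ g(J v, w)` of the metric induced by `φ`. -/
def areaForm (φ : S → C3) (x : S) (v w : TangentSpace 𝓘(ℝ, ℂ) x) : ℝ :=
  inducedMetric φ x (J x v) w

/-- The Hodge star on `2`-forms for the metric induced by `φ`: the function `*η` with
`η = (*η) · area`, computed on the coordinate frame `∂/∂s, ∂/∂t` of the preferred chart. -/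
def starTwo (φ : S → C3) (η : ∀ x : S, TangentSpace 𝓘(ℝ, ℂ) x → TangentSpace 𝓘(ℝ, ℂ) x → ℝ)
    (x : S) : ℝ :=
  η x (1 : ℂ) Complex.I / areaForm φ x (1 : ℂ) Complex.I

/-- The real second order operator `*d(*dρ)`, for the metric induced by `φ`. -/
def starDStarD (φ : S → C3) (ρ : S → ℝ) : S → ℝ :=
  starTwo φ (extD (starOne (diff ρ)))

/-- The `ℂ³`-valued `1`-form `β = φ *dρ - ρ *dφ`. -/
def bryantForm (φ : S → C3) (ρ : S → ℝ) (x : S) : TangentSpace 𝓘(ℝ, ℂ) x →L[ℝ] C3 :=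
  (starOne (diff ρ) x).smulRight (φ x) - ρ x • starOne (diff φ) x

/-- A holomorphic vector field on a Riemann surface: a holomorphic section of its holomorphic
tangent bundle. The section `u + iv` corresponds to the real vector field `u ∂/∂s + v ∂/∂t`. -/
def IsHolomorphicVectorField [IsManifold 𝓘(ℂ) ω S] (w : ∀ x : S, TangentSpace 𝓘(ℂ) x) : Prop :=
  MDifferentiable 𝓘(ℂ) 𝓘(ℂ).tangent (fun x => (⟨x, w x⟩ : TangentBundle 𝓘(ℂ) S))

/-- The Lie derivative `L_w φ` of a vector-valued function along a vector field `w`. -/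
def lieDerivative (w : ∀ x : S, TangentSpace 𝓘(ℂ) x) (φ : S → C3) (x : S) : C3 :=
  diff φ x (w x : ℂ)

/-- The map `(σ, r) ↦ r φ(σ) + ψ(σ)` on `S × ℝ`, which parametrizes
`{r φ(σ) + ψ(σ) : σ ∈ S, r ∈ ℝ}`. -/
def ruledMap (φ ψ : S → C3) (p : S × ℝ) : C3 :=
  p.2 • φ p.1 + ψ p.1

/-- The data `(S, φ)` of an r-oriented two-sided special Lagrangian cone
`N₀ = {r φ(σ) : σ ∈ S, r ∈ ℝ}`, nonsingular (as an immersed submanifold) except at `0`: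
`φ` is a smooth immersion into the unit sphere `𝒮⁵` such that `N₀` is special Lagrangian. -/
structure IsROrientedSLCone (φ : S → C3) : Prop where
  smooth : ContMDiff 𝓘(ℝ, ℂ) 𝓘(ℝ, C3) ∞ φ
  norm_eq_one : ∀ x, ‖φ x‖ = 1
  immersed : ∀ x, IsImmersedAt 𝓘(ℝ, ℂ) φ x
  ruledSL : IsROrientedRuledSL (𝓘(ℝ, ℂ).prod 𝓘(ℝ, ℝ)) 𝓘(ℝ, ℂ) (ruledMap φ 0) Prod.fst φ

/-- The complex structure `J` of `S` is the one determined by the metric induced by `φ` and by the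
orientation of `S` for which the `2`-form `Re Ω(φ, dφ ·, dφ ·)` is positive: `J` is the rotation
by a right angle in the positive direction. -/
structure IsInducedComplexStructure (φ : S → C3) : Prop where
  isometry : ∀ x v, inducedMetric φ x (J x v) (J x v) = inducedMetric φ x v v
  orthogonal : ∀ x v, inducedMetric φ x v (J x v) = 0
  oriented : ∀ x v, v ≠ 0 → 0 < reOmega ![φ x, diff φ x v, diff φ x (J x v)]

end Surface

end RuledSL

end

noncomputable section

namespace RuledSL

/-! Let `×` be the product dual to `Re Ω` and ω the Kähler form. If `u` is a unit vector and ω(u, a)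
= 0, then |u × a| is the length of the part of `a` orthogonal to `u`; hence `u`, `a`, `u × a + c u`,
when independent, span a special Lagrangian plane (`isCalibratedPlane_of_basis`). So `r φ + ψ` is
special Lagrangian once φ × dφ = dφ ∘ J, ω(φ, dψ) = 0 and dψ ∘ J = φ × dψ modulo φ
(`SatisfiesEvolution`). Its singular points are nowhere dense because each line carries at most one.

For the given cone, φ × dφ = dφ ∘ J is the equality case of Re Ω ≤ vol
(`IsROrientedSLCone.cross_diff`). The conditions on ψ are linear, and both summands satisfy them
(`IsLocalCone.evolution`). For the Lie derivative one differentiates the cone equation along `w`;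
holomorphy says that the derivative of `w` commutes with J. For `b`, the form β equals ρ dφ ∘ J
modulo φ, and dφ already satisfies the conditions.

Existence of `b` is where the equation on ρ enters. Differentiating the cone equation gives Δφ =
-2|∂ₛφ|² φ in a conformal coordinate (`IsLocalCone.laplacian_eq`), the equation on ρ reads Δρ =
-2|∂ₛφ|² ρ, and dβ = (φ Δρ - ρ Δφ) ds ∧ dt vanishes. Local primitives are then glued by lifting
through a covering of the simply connected surface (`exists_primitive`). -/

/-! ### Cross product and Kähler form on `ℂ³`. -/

/-- The cross product of `ℂ³` with respect to `g` and `Re Ω`: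
`g (cross u v, w) = Re Ω (u, v, w)`. -/
def crossFun (u v : C3) : C3 :=
  WithLp.toLp 2 ![star (u 1 * v 2 - u 2 * v 1), star (u 2 * v 0 - u 0 * v 2),
    star (u 0 * v 1 - u 1 * v 0)]

theorem inner_eq (u v : C3) :
    inner ℝ u v = (u 0).re * (v 0).re + (u 0).im * (v 0).im + ((u 1).re * (v 1).re
      + (u 1).im * (v 1).im) + ((u 2).re * (v 2).re + (u 2).im * (v 2).im) := by
  simp [PiLp.inner_apply, Fin.sum_univ_three, Complex.inner]
  ring

/-- The Kähler form of `ℂ³`. -/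
def kahler (u v : C3) : ℝ := inner ℝ (Complex.I • u) v

theorem kahler_eq (u v : C3) :
    kahler u v = (u 0).re * (v 0).im - (u 0).im * (v 0).re + ((u 1).re * (v 1).im
      - (u 1).im * (v 1).re) + ((u 2).re * (v 2).im - (u 2).im * (v 2).re) := by
  rw [kahler, inner_eq]
  simp
  ring

theorem reOmega_eq_inner (u v w : C3) : reOmega ![u, v, w] = inner ℝ (crossFun u v) w := by
  rw [inner_eq]
  simp [reOmega, Matrix.det_fin_three, crossFun]
  ring

/-- Lagrange's identity: `crossFun` is the conjugate of the complex cross product, and the squared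
modulus of the Hermitian product is the sum of the squares of `g` and the Kähler form. -/
theorem norm_sq_cross (u v : C3) :
    inner ℝ (crossFun u v) (crossFun u v)
      = inner ℝ u u * inner ℝ v v - (inner ℝ u v) ^ 2 - (kahler u v) ^ 2 := by
  simp only [inner_eq, kahler_eq]
  simp [crossFun]
  ring

/-- By duality the left side is Re Ω(u, v, iu) = Re (i Ω(u, v, u)), and Ω is complex trilinear and
alternating. -/
theorem kahler_cross (u v : C3) : kahler u (crossFun u v) = 0 := by
  rw [kahler_eq]; simp [crossFun]; ring

/-- The cross product as a continuous bilinear map. -/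
def cross : C3 →L[ℝ] C3 →L[ℝ] C3 :=
  LinearMap.mkContinuous₂
    (LinearMap.mk₂ ℝ crossFun
      (by intro a b c; ext i; fin_cases i <;> simp [crossFun] <;> ring)
      (by intro a b c; ext i; fin_cases i <;> simp [crossFun] <;> ring)
      (by intro a b c; ext i; fin_cases i <;> simp [crossFun] <;> ring)
      (by intro a b c; ext i; fin_cases i <;> simp [crossFun] <;> ring)) 1
    (by
      intro u v
      rw [one_mul]
      refine abs_le_of_sq_le_sq' ?_ (by positivity) |>.2
      have := norm_sq_cross u v
      simp only [real_inner_self_eq_norm_sq] at this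
      simp only [LinearMap.mk₂_apply]
      nlinarith [sq_nonneg (inner ℝ u v), sq_nonneg (kahler u v)])

theorem cross_apply (u v : C3) : cross u v = crossFun u v := rfl

theorem reOmega_eq (u v w : C3) : reOmega ![u, v, w] = inner ℝ (cross u v) w :=
  reOmega_eq_inner u v w

theorem cross_self (u : C3) : cross u u = 0 := by
  ext i; fin_cases i <;> simp [cross_apply, crossFun] <;> ring

theorem cross_swap (u v : C3) : cross u v = -cross v u := by
  ext i; fin_cases i <;> simp [cross_apply, crossFun] <;> ring

/-- The Kähler form as a continuous bilinear map. -/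
def kahlerL : C3 →L[ℝ] C3 →L[ℝ] ℝ :=
  (innerSL ℝ).comp ((Complex.I • ContinuousLinearMap.id ℂ C3).restrictScalars ℝ)

theorem kahlerL_apply (u v : C3) : kahlerL u v = kahler u v := rfl

theorem kahlerL_self (u : C3) : kahlerL u u = 0 := by
  rw [kahlerL_apply, kahler_eq]; ring

theorem kahlerL_swap (u v : C3) : kahlerL u v = -kahlerL v u := by
  rw [kahlerL_apply, kahlerL_apply, kahler_eq, kahler_eq]; ring

theorem inner_cross_left (u v : C3) : inner ℝ u (cross u v) = 0 := by
  rw [inner_eq]; simp [cross_apply, crossFun]; ring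

theorem inner_cross_right (u v : C3) : inner ℝ v (cross u v) = 0 := by
  rw [inner_eq]; simp [cross_apply, crossFun]; ring

theorem kahlerL_cross (u v : C3) : kahlerL u (cross u v) = 0 := kahler_cross u v

theorem inner_cross_self (u v : C3) :
    inner ℝ (cross u v) (cross u v)
      = inner ℝ u u * inner ℝ v v - (inner ℝ u v) ^ 2 - (kahlerL u v) ^ 2 := norm_sq_cross u v

theorem inner_cross_rotate (u v w : C3) : inner ℝ (cross u v) w = inner ℝ (cross v w) u := by
  simp only [inner_eq]; simp [cross_apply, crossFun]; ring

/-- The equality case of `Re Ω ≤ vol`. -/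
theorem eq_cross_of_calibrated {u v w : C3}
    (hu : inner ℝ u u = (1 : ℝ)) (hvw : inner ℝ v v = (inner ℝ w w : ℝ))
    (h : inner ℝ (cross u v) w = (inner ℝ w w : ℝ)) : w = cross u v := by
  rw [eq_comm, ← sub_eq_zero, ← inner_self_eq_zero (𝕜 := ℝ)]
  have h1 := inner_cross_self u v
  have h2 : 0 ≤ inner ℝ (cross u v - w) (cross u v - w) := real_inner_self_nonneg
  have h3 := inner_sub_sub_self (𝕜 := ℝ) (cross u v) w
  rw [real_inner_comm (cross u v) w, h] at h3
  rw [hu] at h1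
  -- |u × v - w|² = |u × v|² - |w|² ≤ |v|² - |w|² = 0.
  nlinarith [sq_nonneg (inner ℝ u v), sq_nonneg (kahlerL u v)]

/-- Again equality in Cauchy–Schwarz: |v × w|² ≤ k², while rotating the triple product gives g(v ×
w, k u) = k², so |v × w - k u|² ≤ 0. -/
theorem cross_eq_smul_of_calibrated {u v w : C3} {k : ℝ} (hu : inner ℝ u u = (1 : ℝ))
    (hv : inner ℝ v v = k) (hw : inner ℝ w w = k)
    (h : inner ℝ (cross u v) w = k) : cross v w = k • u := by
  rw [← sub_eq_zero, ← inner_self_eq_zero (𝕜 := ℝ)]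
  have h1 := inner_cross_self v w
  have h2 : 0 ≤ inner ℝ (cross v w - k • u) (cross v w - k • u) := real_inner_self_nonneg
  have h3 := inner_sub_sub_self (𝕜 := ℝ) (cross v w) (k • u)
  have h4 : inner ℝ (cross v w) (k • u) = k * k := by
    rw [inner_smul_right, ← inner_cross_rotate, h]
  have h5 : inner ℝ (k • u) (k • u) = k * k := by
    rw [inner_smul_right, real_inner_smul_left, hu, mul_one]
  rw [real_inner_comm (cross v w) (k • u), h4, h5] at h3
  rw [hv, hw] at h1
  nlinarith [sq_nonneg (inner ℝ v w), sq_nonneg (kahlerL v w)]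

/-! ### Gluing local functions through a covering space. -/

/-- On a simply connected, locally path connected space, local functions with locally constant
differences are, up to locally constant functions, the restrictions of one global function. -/
theorem exists_global_of_locally_constant_sub {S G ι : Type*} [TopologicalSpace S]
    [SimplyConnectedSpace S] [LocallyPathConnectedSpace S] [AddCommGroup G]
    (U : ι → Set S) (hU : ∀ i, IsOpen (U i)) (idx : S → ι) (hidx : ∀ x, x ∈ U (idx x))
    (f : ι → S → G)
    (hf : ∀ i j, ∀ x ∈ U i ∩ U j, ∀ᶠ y in 𝓝 x, f i y - f j y = f i x - f j x) :
    ∃ b : S → G, ∀ i, ∀ x ∈ U i, ∀ᶠ y in 𝓝 x, b y - f i y = b x - f i x := by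
  -- With discrete fibre `G` the bundle below is a covering of `S`.
  let _ : TopologicalSpace G := ⊥
  have _ : DiscreteTopology G := ⟨rfl⟩
  let Z : FiberBundleCore ι S G :=
    { baseSet := U
      isOpen_baseSet := hU
      indexAt := idx
      mem_baseSet_at := hidx
      -- The fibre coordinate over `U i` stands for b - f i, hence this passage to b - f j.
      coordChange := fun i j x v => v + (f i x - f j x)
      coordChange_self := by intro i x _ v; simp
      continuousOn_coordChange := by
        intro i j
        rintro ⟨x, v⟩ ⟨hx, -⟩
        apply ContinuousAt.continuousWithinAt
        have h1 : ∀ᶠ p : S × G in 𝓝 (x, v), f i p.1 - f j p.1 = f i x - f j x :=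
          (continuous_fst.tendsto (x, v)).eventually (hf i j x hx)
        have h2 : ∀ᶠ p : S × G in 𝓝 (x, v), p.2 = v :=
          continuous_snd.continuousAt.eventually (p := (· = v)) ((isOpen_discrete {v}).mem_nhds rfl)
        have h3 : (fun p : S × G => p.2 + (f i p.1 - f j p.1)) =ᶠ[𝓝 (x, v)]
            fun _ => v + (f i x - f j x) := by
          filter_upwards [h1, h2] with p hp1 hp2
          rw [hp1, hp2]
        exact (continuousAt_const).congr h3.symm
      coordChange_comp := by intro i j k x _ v; abel }
  have hcov : IsCoveringMap (Bundle.TotalSpace.proj : Bundle.TotalSpace G Z.Fiber → S) :=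
    FiberBundle.isCoveringMap
  obtain ⟨x₀⟩ : Nonempty S := inferInstance
  -- Lifting the identity of the simply connected base yields a global section, whose coordinates
  -- are locally constant.
  obtain ⟨F, ⟨-, hF⟩, -⟩ := hcov.existsUnique_continuousMap_lifts (ContinuousMap.id S) x₀
    (⟨x₀, (0 : G)⟩ : Bundle.TotalSpace G Z.Fiber) rfl
  have hFp : ∀ x, (F x).1 = x := fun x => congrFun hF x
  refine ⟨fun x => (show G from (F x).2) + f (idx x) x, fun i x hx => ?_⟩
  have hsrc : F x ∈ (Z.localTriv i).source := by
    rw [Z.mem_localTriv_source, hFp, ← Z.baseSet_at]; exact hx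
  have hc : ContinuousAt (fun y => ((Z.localTriv i) (F y)).2) x :=
    continuousAt_snd.comp
      (((Z.localTriv i).continuousAt hsrc).comp F.continuous.continuousAt)
  have he : ∀ᶠ y in 𝓝 x, ((Z.localTriv i) (F y)).2 = ((Z.localTriv i) (F x)).2 :=
    hc.eventually (p := (· = ((Z.localTriv i) (F x)).2)) ((isOpen_discrete {_}).mem_nhds rfl)
  have hval : ∀ y, ((Z.localTriv i) (F y)).2 = (show G from (F y).2) + (f (idx y) y - f i y) := by
    intro y
    rw [Z.localTriv_apply]
    show (show G from (F y).2) + (f (idx (F y).1) (F y).1 - f i (F y).1) = _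
    rw [hFp]
  filter_upwards [he] with y hy
  rw [hval, hval] at hy
  exact (add_sub_assoc _ _ _).trans (hy.trans (add_sub_assoc _ _ _).symm)

/-! ### The cone equations in a conformal coordinate. -/

theorem clm_eq_of_basis {F : Type*} [NormedAddCommGroup F] [NormedSpace ℝ F] (A : ℂ →L[ℝ] F)
    (v : ℂ) : A v = v.re • A 1 + v.im • A Complex.I := by
  conv_lhs => rw [← Complex.re_add_im v]
  rw [← map_smul, ← map_smul, ← map_add]
  simp [Complex.real_smul]

theorem clm_I_mul_I_mul {F : Type*} [NormedAddCommGroup F] [NormedSpace ℝ F] (A : ℂ →L[ℝ] F)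
    (v : ℂ) : A (Complex.I * (Complex.I * v)) = -A v := by
  rw [← mul_assoc, Complex.I_mul_I, neg_one_mul, map_neg]

/-- A bilinear map on `ℂ = ℝ²` is symmetric once it is so on the frame `1, I`. -/
theorem bilin_symm_of_basis {F : Type*} [NormedAddCommGroup F] [NormedSpace ℝ F]
    (A : ℂ →L[ℝ] ℂ →L[ℝ] F) (h : A 1 Complex.I = A Complex.I 1) (u v : ℂ) : A u v = A v u := by
  rw [clm_eq_of_basis (A u) v, clm_eq_of_basis (A v) u, clm_eq_of_basis A u, clm_eq_of_basis A v]
  simp only [add_apply, smul_apply, h, smul_add, smul_smul]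
  simp only [mul_comm v.re, mul_comm v.im]
  abel

/-- The coordinate expression of a map which is the link of a special Lagrangian cone, in a
conformal coordinate on an open subset `T` of `ℂ`. -/
structure IsLocalCone (T : Set ℂ) (f : ℂ → C3) : Prop where
  isOpen : IsOpen T
  smooth : ContDiffOn ℝ ∞ f T
  cross_eq : ∀ y ∈ T, ∀ v, cross (f y) (fderiv ℝ f y v) = fderiv ℝ f y (Complex.I * v)
  cross_deriv : ∀ y ∈ T, cross (fderiv ℝ f y 1) (fderiv ℝ f y Complex.I)
    = (inner ℝ (fderiv ℝ f y 1) (fderiv ℝ f y 1) : ℝ) • f y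

section

variable {F : Type*} [NormedAddCommGroup F] [NormedSpace ℝ F] {T : Set ℂ} {f : ℂ → F}

theorem hasFDerivAt_of_smooth (hT : IsOpen T) (hf : ContDiffOn ℝ ∞ f T) {y : ℂ} (hy : y ∈ T) :
    HasFDerivAt f (fderiv ℝ f y) y :=
  (((hf.contDiffAt (hT.mem_nhds hy))).differentiableAt (by simp)).hasFDerivAt

theorem contDiffOn_fderiv_of_smooth (hT : IsOpen T) (hf : ContDiffOn ℝ ∞ f T) :
    ContDiffOn ℝ ∞ (fderiv ℝ f) T :=
  hf.fderiv_of_isOpen hT (by simp)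

theorem hasFDerivAt_fderiv_apply (hT : IsOpen T) (hf : ContDiffOn ℝ ∞ f T) {y : ℂ} (hy : y ∈ T)
    (v : ℂ) : HasFDerivAt (fun z => fderiv ℝ f z v) ((fderiv ℝ (fderiv ℝ f) y).flip v) y := by
  have h := (hasFDerivAt_of_smooth hT (contDiffOn_fderiv_of_smooth hT hf) hy).clm_apply
    (hasFDerivAt_const v y)
  convert! h using 1
  ext u
  simp

theorem fderiv_fderiv_symm (hT : IsOpen T) (hf : ContDiffOn ℝ ∞ f T) {y : ℂ} (hy : y ∈ T)
    (u v : ℂ) : fderiv ℝ (fderiv ℝ f) y u v = fderiv ℝ (fderiv ℝ f) y v u :=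
  ((hf.contDiffAt (hT.mem_nhds hy)).isSymmSndFDerivAt (by
    rw [minSmoothness_of_isRCLikeNormedField]; exact WithTop.coe_le_coe.2 (le_top (a := (2 : ℕ∞))))).eq u v

end

namespace IsLocalCone

variable {T : Set ℂ} {f : ℂ → C3}

/-- Since I² = -1, the cone equation makes every value of df a product `f × _`, and such products
are Kähler-orthogonal to `f`. -/
theorem kahlerL_fderiv (h : IsLocalCone T f) {y : ℂ} (hy : y ∈ T) (v : ℂ) :
    kahlerL (f y) (fderiv ℝ f y v) = 0 := by
  have h1 := h.cross_eq y hy (Complex.I * v)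
  rw [clm_I_mul_I_mul] at h1
  rw [← neg_eq_zero, ← map_neg, ← h1, kahlerL_cross]

theorem kahlerL_fderiv_fderiv (h : IsLocalCone T f) {y : ℂ} (hy : y ∈ T) (u v : ℂ) :
    kahlerL (fderiv ℝ f y u) (fderiv ℝ f y v) = 0 := by
  have h1 : kahlerL (fderiv ℝ f y 1) (fderiv ℝ f y Complex.I) = 0 := by
    have h2 := h.cross_eq y hy 1
    rw [mul_one, cross_swap] at h2
    rw [← h2, map_neg, kahlerL_cross, neg_zero]
  have h3 : kahlerL (fderiv ℝ f y Complex.I) (fderiv ℝ f y 1) = 0 := by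
    rw [kahlerL_swap, h1, neg_zero]
  rw [clm_eq_of_basis (fderiv ℝ f y) u, clm_eq_of_basis (fderiv ℝ f y) v]
  simp [h1, h3, kahlerL_self]

/-- By alternation only the pair (1, I) matters. This makes the quadratic term of the differentiated
cone equation disappear modulo `f`. -/
theorem cross_fderiv_fderiv (h : IsLocalCone T f) {y : ℂ} (hy : y ∈ T) (u v : ℂ) :
    ∃ c : ℝ, cross (fderiv ℝ f y u) (fderiv ℝ f y v) = c • f y := by
  have h1 := h.cross_deriv y hy
  have h2 : cross (fderiv ℝ f y Complex.I) (fderiv ℝ f y 1)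
      = -((inner ℝ (fderiv ℝ f y 1) (fderiv ℝ f y 1) : ℝ) • f y) := by
    rw [cross_swap, h1]
  rw [clm_eq_of_basis (fderiv ℝ f y) u, clm_eq_of_basis (fderiv ℝ f y) v]
  simp only [map_add, map_smul, add_apply, smul_apply, h1,
    h2, cross_self, smul_zero, add_zero, zero_add, ← neg_smul, smul_smul, ← add_smul]
  exact ⟨_, rfl⟩

/-- The derivative of `f × df = df ∘ J`. -/
theorem cross_add_cross (h : IsLocalCone T f) {y : ℂ} (hy : y ∈ T) (u v : ℂ) :
    cross (fderiv ℝ f y u) (fderiv ℝ f y v) + cross (f y) (fderiv ℝ (fderiv ℝ f) y u v)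
      = fderiv ℝ (fderiv ℝ f) y u (Complex.I * v) := by
  have h1 := cross.hasFDerivAt_of_bilinear (hasFDerivAt_of_smooth h.isOpen h.smooth hy)
    (hasFDerivAt_fderiv_apply h.isOpen h.smooth hy v)
  have h2 := hasFDerivAt_fderiv_apply h.isOpen h.smooth hy (Complex.I * v)
  have h3 : (fun z => cross (f z) (fderiv ℝ f z v))
      =ᶠ[𝓝 y] fun z => fderiv ℝ f z (Complex.I * v) := by
    filter_upwards [h.isOpen.mem_nhds hy] with z hz using h.cross_eq z hz v
  have h4 := congrArg (fun A : ℂ →L[ℝ] C3 => A u) (h1.unique (h2.congr_of_eventuallyEq h3))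
  simp only [add_apply, ContinuousLinearMap.precompR_apply,
    ContinuousLinearMap.precompL_apply, ContinuousLinearMap.flip_apply] at h4
  rw [add_comm]
  exact h4

/-- Differentiate ω(f, df(v)) = 0; the other term ω(df(u), df(v)) vanishes as well. -/
theorem kahlerL_snd (h : IsLocalCone T f) {y : ℂ} (hy : y ∈ T) (u v : ℂ) :
    kahlerL (f y) (fderiv ℝ (fderiv ℝ f) y u v) = 0 := by
  have h1 := kahlerL.hasFDerivAt_of_bilinear (hasFDerivAt_of_smooth h.isOpen h.smooth hy)
    (hasFDerivAt_fderiv_apply h.isOpen h.smooth hy v)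
  have h3 : (fun z => kahlerL (f z) (fderiv ℝ f z v)) =ᶠ[𝓝 y] fun z => 0 := by
    filter_upwards [h.isOpen.mem_nhds hy] with z hz using h.kahlerL_fderiv hz v
  have h4 := congrArg (fun A : ℂ →L[ℝ] ℝ => A u)
    (h1.unique ((hasFDerivAt_const (0 : ℝ) y).congr_of_eventuallyEq h3))
  simp only [add_apply, ContinuousLinearMap.precompR_apply,
    ContinuousLinearMap.precompL_apply] at h4
  rw [h.kahlerL_fderiv_fderiv hy, add_zero] at h4
  exact h4

/-- `cross_add_cross` with its arguments exchanged: symmetry of the second derivative moves `I` to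
the first slot. -/
theorem snd_mul_I (h : IsLocalCone T f) {y : ℂ} (hy : y ∈ T) (u v : ℂ) :
    fderiv ℝ (fderiv ℝ f) y (Complex.I * u) v
      = cross (f y) (fderiv ℝ (fderiv ℝ f) y u v) - cross (fderiv ℝ f y u) (fderiv ℝ f y v) := by
  have h1 := h.cross_add_cross hy v u
  rw [fderiv_fderiv_symm h.isOpen h.smooth hy v, fderiv_fderiv_symm h.isOpen h.smooth hy v,
    cross_swap] at h1
  rw [← h1]; abel

/-- `f` is harmonic as a map to the sphere. -/
theorem laplacian_eq (h : IsLocalCone T f) {y : ℂ} (hy : y ∈ T) :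
    fderiv ℝ (fderiv ℝ f) y 1 1 + fderiv ℝ (fderiv ℝ f) y Complex.I Complex.I
      = -(2 * inner ℝ (fderiv ℝ f y 1) (fderiv ℝ f y 1) : ℝ) • f y := by
  -- `h1` expresses -D²f(1, 1) and `h2` expresses D²f(I, I). On subtracting, f × D²f(1, I) cancels
  -- and twice df(1) × df(I) remains, which `h3` evaluates.
  have h1 := h.cross_add_cross hy 1 Complex.I
  have h2 := h.snd_mul_I hy 1 Complex.I
  have h3 := h.cross_deriv y hy
  rw [mul_one] at h2
  rw [Complex.I_mul_I, map_neg] at h1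
  have h4 : fderiv ℝ (fderiv ℝ f) y 1 1 = -(cross (fderiv ℝ f y 1) (fderiv ℝ f y Complex.I)
      + cross (f y) (fderiv ℝ (fderiv ℝ f) y 1 Complex.I)) := by rw [h1, neg_neg]
  rw [h4, h2, h3]
  module

end IsLocalCone

/-! ### The form β in a coordinate, and the displacement. -/

/-- The coordinate expression of `f *dρ - ρ *df`. -/
def localBryantForm (f : ℂ → C3) (ρ : ℂ → ℝ) (y : ℂ) : ℂ →L[ℝ] C3 :=
  (-(fderiv ℝ ρ y).comp (ContinuousLinearMap.mul ℝ ℂ Complex.I)).smulRight (f y)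
    - ρ y • -(fderiv ℝ f y).comp (ContinuousLinearMap.mul ℝ ℂ Complex.I)

theorem localBryantForm_apply (f : ℂ → C3) (ρ : ℂ → ℝ) (y v : ℂ) :
    localBryantForm f ρ y v = -(fderiv ℝ ρ y (Complex.I * v)) • f y
      + ρ y • fderiv ℝ f y (Complex.I * v) := by
  simp [localBryantForm]

theorem contDiffOn_localBryantForm {T : Set ℂ} (hT : IsOpen T) {f : ℂ → C3} {ρ : ℂ → ℝ}
    (hf : ContDiffOn ℝ ∞ f T) (hρ : ContDiffOn ℝ ∞ ρ T) :
    ContDiffOn ℝ ∞ (localBryantForm f ρ) T := by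
  have h1 := contDiffOn_fderiv_of_smooth hT hf
  have h2 := contDiffOn_fderiv_of_smooth hT hρ
  exact ((h2.clm_comp contDiffOn_const).neg.smulRight hf).sub
    (hρ.smul (h1.clm_comp contDiffOn_const).neg)

theorem fderiv_localBryantForm_apply {T : Set ℂ} (hT : IsOpen T) {f : ℂ → C3} {ρ : ℂ → ℝ}
    (hf : ContDiffOn ℝ ∞ f T) (hρ : ContDiffOn ℝ ∞ ρ T) {y : ℂ} (hy : y ∈ T) (u v : ℂ) :
    fderiv ℝ (localBryantForm f ρ) y u v
      = -(fderiv ℝ (fderiv ℝ ρ) y u (Complex.I * v)) • f y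
        - fderiv ℝ ρ y (Complex.I * v) • fderiv ℝ f y u
        + (fderiv ℝ ρ y u • fderiv ℝ f y (Complex.I * v)
        + ρ y • fderiv ℝ (fderiv ℝ f) y u (Complex.I * v)) := by
  have h0 := (hasFDerivAt_of_smooth hT (contDiffOn_localBryantForm hT hf hρ) hy).clm_apply
    (hasFDerivAt_const v y)
  have h2 := ((hasFDerivAt_fderiv_apply hT hρ hy (Complex.I * v)).neg.smul
    (hasFDerivAt_of_smooth hT hf hy)).add ((hasFDerivAt_of_smooth hT hρ hy).smul
    (hasFDerivAt_fderiv_apply hT hf hy (Complex.I * v)))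
  have h3 := h0.unique (h2.congr_of_eventuallyEq (Filter.Eventually.of_forall fun z =>
    localBryantForm_apply f ρ z v))
  have h4 := congrArg (fun A : ℂ →L[ℝ] C3 => A u) h3
  simp at h4
  rw [h4]
  module

/-- On the frame (1, I) the products of first derivatives cancel, leaving f Δρ - ρ Δf. Both
Laplacians have the same eigenvalue factor -2|df(1)|². -/
theorem IsLocalCone.localBryantForm_closed {T : Set ℂ} {f : ℂ → C3} (h : IsLocalCone T f)
    {ρ : ℂ → ℝ} (hρ : ContDiffOn ℝ ∞ ρ T)
    {y : ℂ} (hy : y ∈ T) (heq : fderiv ℝ (fderiv ℝ ρ) y 1 1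
      + fderiv ℝ (fderiv ℝ ρ) y Complex.I Complex.I
      + 2 * inner ℝ (fderiv ℝ f y 1) (fderiv ℝ f y 1) * ρ y = 0) (u v : ℂ) :
    fderiv ℝ (localBryantForm f ρ) y u v = fderiv ℝ (localBryantForm f ρ) y v u := by
  refine bilin_symm_of_basis _ ?_ u v
  have h1 := h.laplacian_eq hy
  rw [fderiv_localBryantForm_apply h.isOpen h.smooth hρ hy,
    fderiv_localBryantForm_apply h.isOpen h.smooth hρ hy]
  simp only [mul_one, Complex.I_mul_I, map_neg]
  have h3 : fderiv ℝ (fderiv ℝ f) y 1 1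
      = -(2 * inner ℝ (fderiv ℝ f y 1) (fderiv ℝ f y 1) : ℝ) • f y
        - fderiv ℝ (fderiv ℝ f) y Complex.I Complex.I := by rw [← h1]; abel
  have h4 : fderiv ℝ (fderiv ℝ ρ) y 1 1 = -(2 * inner ℝ (fderiv ℝ f y 1) (fderiv ℝ f y 1) * ρ y)
      - fderiv ℝ (fderiv ℝ ρ) y Complex.I Complex.I := by linarith
  rw [h3, h4]
  module

/-- Pullback by a `C²` map preserves closed `1`-forms. -/
theorem fderiv_symm_of_pullback {F : Type*} [NormedAddCommGroup F] [NormedSpace ℝ F]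
    {a a' : ℂ → ℂ →L[ℝ] F} {τ : ℂ → ℂ} {y : ℂ} (hτ : ContDiffAt ℝ ∞ τ y)
    (ha : DifferentiableAt ℝ a (τ y))
    (hsymm : ∀ u v, fderiv ℝ a (τ y) u v = fderiv ℝ a (τ y) v u)
    (h : ∀ᶠ z in 𝓝 y, a' z = (a (τ z)).comp (fderiv ℝ τ z)) (u v : ℂ) :
    fderiv ℝ a' y u v = fderiv ℝ a' y v u := by
  have h1 : HasFDerivAt τ (fderiv ℝ τ y) y := (hτ.differentiableAt (by simp)).hasFDerivAt
  have h2 : HasFDerivAt (fderiv ℝ τ) (fderiv ℝ (fderiv ℝ τ) y) y :=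
    ((hτ.fderiv_right (m := ∞) (by simp)).differentiableAt (by simp)).hasFDerivAt
  -- The derivative has two terms, Da(Dτ u)(Dτ v) and a(D²τ(u, v)), each symmetric in u and v.
  have h3 := (HasFDerivAt.comp y ha.hasFDerivAt h1).clm_comp h2
  have h4 : HasFDerivAt a' _ y := h3.congr_of_eventuallyEq h
  have h5 : fderiv ℝ (fderiv ℝ τ) y u v = fderiv ℝ (fderiv ℝ τ) y v u :=
    (hτ.isSymmSndFDerivAt (by
      rw [minSmoothness_of_isRCLikeNormedField]
      exact WithTop.coe_le_coe.2 (le_top (a := (2 : ℕ∞))))).eq u v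
  rw [h4.fderiv]
  simp [h5, hsymm (fderiv ℝ τ y u)]

/-- The displacement `df(w) + b`, with `db = f *dρ - ρ *df`, satisfies the evolution equation of
ruled special Lagrangian 3-folds. -/
theorem IsLocalCone.evolution {T : Set ℂ} {f : ℂ → C3} (h : IsLocalCone T f) {ρ : ℂ → ℝ}
    {W : ℂ → ℂ} {b : ℂ → C3} {y : ℂ} (hy : y ∈ T) (hW : DifferentiableAt ℂ W y)
    (hb : HasFDerivAt b (localBryantForm f ρ y) y) {D : ℂ →L[ℝ] C3}
    (hD : HasFDerivAt (fun z => fderiv ℝ f z (W z) + b z) D y) :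
    (∀ v, kahlerL (f y) (D v) = 0) ∧
      ∀ v, ∃ c : ℝ, D (Complex.I * v) = cross (f y) (D v) + c • f y := by
  have hDv : ∀ v, D v = fderiv ℝ (fderiv ℝ f) y v (W y) + fderiv ℝ f y (deriv W y * v)
      + localBryantForm f ρ y v := by
    intro v
    have h1 := ((hasFDerivAt_of_smooth h.isOpen (contDiffOn_fderiv_of_smooth h.isOpen h.smooth)
      hy).clm_apply (hW.hasDerivAt.hasFDerivAt.restrictScalars ℝ)).add hb
    rw [hD.unique h1]
    simp [add_comm, mul_comm]
  refine ⟨fun v => ?_, fun v => ?_⟩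
  · rw [hDv, localBryantForm_apply]
    simp [h.kahlerL_snd hy, h.kahlerL_fderiv hy, kahlerL_self]
  -- Each of the three summands of `D` obeys the equation modulo `f`: D²f(v, W) by `snd_mul_I`, with
  -- error -c f; df(W′v) because W′ is a complex multiplication and commutes with `I`; and β, whose
  -- part off `f` is ρ df(Iv), with error dρ(v) f.
  · obtain ⟨c, hc⟩ := h.cross_fderiv_fderiv hy v (W y)
    have h2 := h.cross_eq y hy (deriv W y * v)
    have h3 := h.cross_eq y hy (Complex.I * v)
    have h4 : Complex.I * (deriv W y * v) = deriv W y * (Complex.I * v) := by ring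
    rw [h4] at h2
    refine ⟨-c + fderiv ℝ ρ y v, ?_⟩
    rw [hDv, hDv, localBryantForm_apply, localBryantForm_apply, h.snd_mul_I hy, hc, map_add,
      map_add, map_add, map_smul, map_smul, cross_self, h2, h3, clm_I_mul_I_mul, clm_I_mul_I_mul]
    module

/-! ### Calibrated planes. -/

/-- `Re Ω` as an alternating map on a real subspace of `ℂ³`. -/
def reOmegaAlt (V : Submodule ℝ C3) : V [⋀^Fin 3]→ₗ[ℝ] ℝ :=
  { toFun := fun v => reOmega fun i => (v i : C3)
    map_update_add' := by
      intro inst m i x y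
      obtain rfl : inst = instDecidableEqFin 3 := Subsingleton.elim _ _
      fin_cases i <;> simp [reOmega, Matrix.det_fin_three] <;> ring
    map_update_smul' := by
      intro inst m i c x
      obtain rfl : inst = instDecidableEqFin 3 := Subsingleton.elim _ _
      fin_cases i <;> simp [reOmega, Matrix.det_fin_three] <;> ring
    map_eq_zero_of_eq' := by
      intro v i j h hij
      have : (Matrix.det (Matrix.of fun i j : Fin 3 => (v i : C3) j)) = 0 :=
        Matrix.det_zero_of_row_eq hij (by ext k; simp [h])
      simp [reOmega, this] }

theorem reOmegaAlt_apply (V : Submodule ℝ C3) (v : Fin 3 → V) :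
    reOmegaAlt V v = reOmega fun i => (v i : C3) := rfl

theorem volumeForm_basis_pos_iff {V : Type*} [NormedAddCommGroup V] [InnerProductSpace ℝ V]
    [hV : Fact (Module.finrank ℝ V = 3)] (o : Orientation ℝ V (Fin 3))
    (B : Module.Basis (Fin 3) ℝ V) : 0 < o.volumeForm B ↔ o = B.orientation := by
  have h2 := o.finOrthonormalBasis_orientation (by norm_num) hV.out
  have h1 := o.volumeForm_robust (o.finOrthonormalBasis (by norm_num) hV.out) h2
  rw [h1, ← Module.Basis.orientation_eq_iff_det_pos, h2]

theorem abs_volumeForm_orthogonal_triple {V : Type*} [NormedAddCommGroup V]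
    [InnerProductSpace ℝ V] [Fact (Module.finrank ℝ V = 3)] (o : Orientation ℝ V (Fin 3))
    {u v w : V} (huv : inner ℝ u v = (0 : ℝ)) (huw : inner ℝ u w = (0 : ℝ))
    (hvw : inner ℝ v w = (0 : ℝ)) : |o.volumeForm ![u, v, w]| = ‖u‖ * ‖v‖ * ‖w‖ := by
  rw [o.abs_volumeForm_apply_of_pairwise_orthogonal, Fin.prod_univ_three]
  · rfl
  · intro i j hij
    fin_cases i <;> fin_cases j <;>
      first
      | exact absurd rfl hij
      | assumption
      | (rw [real_inner_comm]; assumption)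

/-- An alternating `3`-form that is positive on an oriented basis, and is the product of the norms
on an orthogonal frame, is the volume form. -/
theorem eq_volumeForm_of_orthogonal_triple {V : Type*} [NormedAddCommGroup V]
    [InnerProductSpace ℝ V] [Fact (Module.finrank ℝ V = 3)] (o : Orientation ℝ V (Fin 3))
    (A : V [⋀^Fin 3]→ₗ[ℝ] ℝ) (B : Module.Basis (Fin 3) ℝ V) (ho : o = B.orientation)
    {u v w : V} (huv : inner ℝ u v = (0 : ℝ)) (huw : inner ℝ u w = (0 : ℝ))
    (hvw : inner ℝ v w = (0 : ℝ)) (hpos : 0 < A B) (hA : A ![u, v, w] = ‖u‖ * ‖v‖ * ‖w‖)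
    (hne : 0 < A ![u, v, w]) (x : Fin 3 → V) : A x = o.volumeForm x := by
  have h1 := abs_volumeForm_orthogonal_triple o huv huw hvw
  have h2 := (volumeForm_basis_pos_iff o B).2 ho
  -- Top-degree forms are all multiples of `B.det`. The orthogonal triple compares the two factors
  -- up to sign, and positivity on `B` fixes the sign.
  have e1 : ∀ y, A y = A B * B.det y := fun y => by
    conv_lhs => rw [A.eq_smul_basis_det B]
    rfl
  have e2 : ∀ y, o.volumeForm y = o.volumeForm B * B.det y := fun y => by
    conv_lhs => rw [o.volumeForm.eq_smul_basis_det B]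
    rfl
  have hdet : 0 < B.det ![u, v, w] := by
    rw [e1] at hne
    exact (pos_iff_pos_of_mul_pos hne).1 hpos
  rw [← hA, e1, e2, abs_of_pos (mul_pos h2 hdet)] at h1
  rw [e1, e2, mul_right_cancel₀ hdet.ne' h1]

theorem volumeForm_basis_pos_iff_of_submodule (V : Submodule ℝ C3)
    [Fact (Module.finrank ℝ V = 3)] (o : Orientation ℝ V (Fin 3))
    (B : Module.Basis (Fin 3) ℝ V) : 0 < o.volumeForm B ↔ o = B.orientation :=
  volumeForm_basis_pos_iff (V := V) o B

/-- An orientation that calibrates is determined by the sign of `Re Ω` on frames. -/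
theorem IsCalibratedPlane.orientation_eq {V : Submodule ℝ C3} {o : Orientation ℝ V (Fin 3)}
    (h : IsCalibratedPlane V o) (B : Module.Basis (Fin 3) ℝ V)
    (hB : 0 < reOmega fun i => (B i : C3)) : B.orientation = o := by
  obtain ⟨hV, h⟩ := h
  have h0 := h B
  rw [h0] at hB
  exact ((volumeForm_basis_pos_iff_of_submodule V o B).1 hB).symm

/-- The absolute value avoids knowing whether the triple is positive for `o`; for the cone the sign
is supplied by the orientation of the surface. -/
theorem IsCalibratedPlane.abs_reOmega {V : Submodule ℝ C3} {o : Orientation ℝ V (Fin 3)}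
    (h : IsCalibratedPlane V o) {u v w : C3} (hu : u ∈ V) (hv : v ∈ V) (hw : w ∈ V)
    (huv : inner ℝ u v = (0 : ℝ)) (huw : inner ℝ u w = (0 : ℝ)) (hvw : inner ℝ v w = (0 : ℝ)) :
    |reOmega ![u, v, w]| = ‖u‖ * ‖v‖ * ‖w‖ := by
  obtain ⟨hV, h⟩ := h
  have h1 := h ![⟨u, hu⟩, ⟨v, hv⟩, ⟨w, hw⟩]
  have h2 : (fun i => ((![⟨u, hu⟩, ⟨v, hv⟩, ⟨w, hw⟩] : Fin 3 → V) i : C3)) = ![u, v, w] := by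
    ext i; fin_cases i <;> rfl
  rw [h2] at h1
  rw [h1]
  exact abs_volumeForm_orthogonal_triple (V := V) o (u := ⟨u, hu⟩) (v := ⟨v, hv⟩) (w := ⟨w, hw⟩) huv huw hvw

/-- The plane spanned by `u`, `a`, `u × a + c u` is special Lagrangian if `u` is a unit vector
and `a` is Kähler-orthogonal to `u`. -/
theorem isCalibratedPlane_of_basis {V : Submodule ℝ C3} (B : Module.Basis (Fin 3) ℝ V)
    {u a : C3} {c : ℝ} (h0 : (B 0 : C3) = u) (h1 : (B 1 : C3) = a)
    (h2 : (B 2 : C3) = cross u a + c • u) (hu : inner ℝ u u = (1 : ℝ)) (hua : kahlerL u a = 0) :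
    0 < reOmega (fun i => (B i : C3)) ∧ IsCalibratedPlane V B.orientation := by
  have hV : Module.finrank ℝ V = 3 := by simp [Module.finrank_eq_card_basis B]
  have hcross : cross u a ≠ 0 := by
    intro h
    rw [h, zero_add] at h2
    have h3 : B 2 = c • B 0 := by ext1; simp [h2, h0]
    have h4 := congrArg (fun x => B.repr x 2) h3
    simp at h4
  have hpos : 0 < inner ℝ (cross u a) (cross u a) :=
    real_inner_self_pos.2 hcross
  have hBeq : (fun i => (B i : C3)) = ![u, a, cross u a + c • u] := by
    ext i; fin_cases i <;> simp [h0, h1, h2]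
  have hB : reOmega (fun i => (B i : C3)) = inner ℝ (cross u a) (cross u a) := by
    rw [hBeq, reOmega_eq, inner_add_right, inner_smul_right, real_inner_comm,
      real_inner_comm u, inner_cross_left]
    simp
  refine ⟨by rwa [hB], ⟨hV⟩, ?_⟩
  have _ : Fact (Module.finrank ℝ V = 3) := ⟨hV⟩
  have huV : u ∈ V := h0 ▸ (B 0).2
  have haV : a ∈ V := h1 ▸ (B 1).2
  have hcV : cross u a ∈ V := by
    have := V.sub_mem (B 2).2 (V.smul_mem c (B 0).2)
    rwa [h0, h2, add_sub_cancel_right] at this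
  -- Removing the `u`-component of `a` changes neither u × a nor the Kähler condition, and makes (u,
  -- q, u × a) an orthogonal frame with |u × a| = |q|.
  set q : C3 := a - (inner ℝ u a : ℝ) • u with hq
  have hqV : q ∈ V := V.sub_mem haV (V.smul_mem _ huV)
  have huq : inner ℝ u q = (0 : ℝ) := by
    rw [hq, inner_sub_right, inner_smul_right, hu]; ring
  have hcq : cross u q = cross u a := by simp only [hq, map_sub, map_smul, cross_self]; simp
  have hkq : kahlerL u q = 0 := by rw [hq, map_sub, map_smul, kahlerL_self, hua]; simp
  have hqq : inner ℝ q q = (inner ℝ (cross u a) (cross u a) : ℝ) := by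
    rw [← hcq, inner_cross_self, hu, huq, hkq]; ring
  have hv : (fun i => ((![⟨u, huV⟩, ⟨q, hqV⟩, ⟨cross u a, hcV⟩] : Fin 3 → V) i : C3))
      = ![u, q, cross u a] := by ext i; fin_cases i <;> rfl
  have hval : reOmegaAlt V ![⟨u, huV⟩, ⟨q, hqV⟩, ⟨cross u a, hcV⟩]
      = inner ℝ (cross u a) (cross u a) := by
    rw [reOmegaAlt_apply, hv, reOmega_eq, hcq]
  have hnorm : ‖u‖ * ‖q‖ * ‖cross u a‖ = inner ℝ (cross u a) (cross u a) := by
    have e1 : ‖u‖ = 1 := by rw [norm_eq_sqrt_real_inner, hu, Real.sqrt_one]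
    have e2 : ‖q‖ = ‖cross u a‖ := by
      rw [norm_eq_sqrt_real_inner, hqq, ← norm_eq_sqrt_real_inner]
    rw [e1, e2, real_inner_self_eq_norm_sq]; ring
  have hqc : inner ℝ q (cross u a) = (0 : ℝ) := by
    rw [← hcq]
    exact inner_cross_right u q
  have hBpos : 0 < reOmegaAlt V B := by rw [reOmegaAlt_apply, hB]; exact hpos
  exact eq_volumeForm_of_orthogonal_triple (V := V) B.orientation (reOmegaAlt V) B rfl
    (u := ⟨u, huV⟩) (v := ⟨q, hqV⟩) (w := ⟨cross u a, hcV⟩) huq (inner_cross_left u a) hqc hBpos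
    (hval.trans hnorm.symm) (hval ▸ hpos)

/-! ### Charts of a Riemann surface, seen as real and as complex. -/

theorem isManifold_real (S : Type*) [TopologicalSpace S] [ChartedSpace ℂ S]
    [IsManifold 𝓘(ℂ) ω S] : IsManifold 𝓘(ℝ, ℂ) ∞ S := by
  refine isManifold_of_contDiffOn _ _ _ fun e e' he he' => ?_
  have h := ((contDiffGroupoid ω 𝓘(ℂ)).compatible he he').1
  exact (h.restrict_scalars ℝ).of_le le_top

theorem hasMFDerivAt_restrictScalars {M N : Type*} [TopologicalSpace M] [ChartedSpace ℂ M]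
    [TopologicalSpace N] [ChartedSpace ℂ N] {f : M → N} {x : M} {A : ℂ →L[ℂ] ℂ}
    (h : HasMFDerivAt 𝓘(ℂ) 𝓘(ℂ) f x A) :
    HasMFDerivAt 𝓘(ℝ, ℂ) 𝓘(ℝ, ℂ) f x (A.restrictScalars ℝ : ℂ →L[ℝ] ℂ) :=
  ⟨h.1, HasFDerivWithinAt.restrictScalars ℝ h.2⟩

section

variable {S : Type*} [TopologicalSpace S] [ChartedSpace ℂ S] {F : Type*} [NormedAddCommGroup F]
  [NormedSpace ℝ F]

theorem hasMFDerivAt_ruledMap {φ ψ : S → C3} {x : S} {A B : ℂ →L[ℝ] C3}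
    (hA : HasMFDerivAt 𝓘(ℝ, ℂ) 𝓘(ℝ, C3) φ x A) (hB : HasMFDerivAt 𝓘(ℝ, ℂ) 𝓘(ℝ, C3) ψ x B)
    (r : ℝ) :
    HasMFDerivAt (𝓘(ℝ, ℂ).prod 𝓘(ℝ, ℝ)) 𝓘(ℝ, C3) (ruledMap φ ψ) (x, r)
      ((ContinuousLinearMap.snd ℝ ℂ ℝ).smulRight (φ x)
        + (r • A + B).comp (ContinuousLinearMap.fst ℝ ℂ ℝ) : ℂ × ℝ →L[ℝ] C3) := by
  have h1 : HasMFDerivAt (𝓘(ℝ, ℂ).prod 𝓘(ℝ, ℝ)) 𝓘(ℝ, C3) (fun p : S × ℝ => φ p.1) (x, r)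
      (A.comp (ContinuousLinearMap.fst ℝ ℂ ℝ) : ℂ × ℝ →L[ℝ] C3) :=
    HasMFDerivAt.comp (x, r) hA (hasMFDerivAt_fst (x := (x, r)))
  have h2 : HasMFDerivAt (𝓘(ℝ, ℂ).prod 𝓘(ℝ, ℝ)) 𝓘(ℝ, C3) (fun p : S × ℝ => ψ p.1) (x, r)
      (B.comp (ContinuousLinearMap.fst ℝ ℂ ℝ) : ℂ × ℝ →L[ℝ] C3) :=
    HasMFDerivAt.comp (x, r) hB (hasMFDerivAt_fst (x := (x, r)))
  have h3 : HasMFDerivAt (𝓘(ℝ, ℂ).prod 𝓘(ℝ, ℝ)) 𝓘(ℝ, ℝ) (Prod.snd : S × ℝ → ℝ) (x, r)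
      (ContinuousLinearMap.snd ℝ ℂ ℝ : ℂ × ℝ →L[ℝ] ℝ) := hasMFDerivAt_snd (x := (x, r))
  refine ⟨?_, ?_⟩
  · exact (h3.1.smul h1.1).add h2.1
  · have := (HasFDerivWithinAt.smul h3.2 h1.2).add h2.2
    refine this.congr_fderiv ?_
    have e1 : writtenInExtChartAt (𝓘(ℝ, ℂ).prod 𝓘(ℝ, ℝ)) 𝓘(ℝ, ℝ) (x, r) (Prod.snd : S × ℝ → ℝ)
        (extChartAt (𝓘(ℝ, ℂ).prod 𝓘(ℝ, ℝ)) (x, r) (x, r)) = r := rfl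
    have e2 : writtenInExtChartAt (𝓘(ℝ, ℂ).prod 𝓘(ℝ, ℝ)) 𝓘(ℝ, C3) (x, r)
        (fun p : S × ℝ => φ p.1) (extChartAt (𝓘(ℝ, ℂ).prod 𝓘(ℝ, ℝ)) (x, r) (x, r)) = φ x :=
      congrArg φ ((chartAt ℂ x).left_inv (mem_chart_source ℂ x))
    rw [e1, e2, ContinuousLinearMap.add_comp, ContinuousLinearMap.smul_comp]
    abel

/-- The derivative of the inverse of the preferred chart at `x₀`. -/
def chartSymmDeriv (x₀ : S) (y : ℂ) : ℂ →L[ℝ] ℂ :=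
  mfderiv 𝓘(ℝ, ℂ) 𝓘(ℝ, ℂ) (extChartAt 𝓘(ℝ, ℂ) x₀).symm y

/-- The derivative of the preferred chart at `x₀`, at the point with coordinate `y`. -/
def chartDeriv (x₀ : S) (y : ℂ) : ℂ →L[ℝ] ℂ :=
  mfderiv 𝓘(ℝ, ℂ) 𝓘(ℝ, ℂ) (extChartAt 𝓘(ℝ, ℂ) x₀) ((extChartAt 𝓘(ℝ, ℂ) x₀).symm y)

theorem mdifferentiableAt_chart_symm [IsManifold 𝓘(ℝ, ℂ) ∞ S] (x₀ : S) {y : ℂ}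
    (hy : y ∈ (extChartAt 𝓘(ℝ, ℂ) x₀).target) :
    MDifferentiableAt 𝓘(ℝ, ℂ) 𝓘(ℝ, ℂ) (extChartAt 𝓘(ℝ, ℂ) x₀).symm y :=
  ((contMDiffOn_extChartAt_symm (n := ∞) x₀).contMDiffAt
    ((isOpen_extChartAt_target x₀).mem_nhds hy)).mdifferentiableAt (by simp)

/-- The chain rule for a function read in a chart. -/
theorem hasFDerivAt_comp_chart_symm [IsManifold 𝓘(ℝ, ℂ) ∞ S] (x₀ : S) {y : ℂ}
    (hy : y ∈ (extChartAt 𝓘(ℝ, ℂ) x₀).target) {f : S → F} {A : ℂ →L[ℝ] F}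
    (hf : HasMFDerivAt 𝓘(ℝ, ℂ) 𝓘(ℝ, F) f ((extChartAt 𝓘(ℝ, ℂ) x₀).symm y) A) :
    HasFDerivAt (f ∘ (extChartAt 𝓘(ℝ, ℂ) x₀).symm)
      (A.comp (chartSymmDeriv x₀ y)) y :=
  (HasMFDerivAt.comp y hf (mdifferentiableAt_chart_symm x₀ hy).hasMFDerivAt).hasFDerivAt

theorem fderiv_comp_chart_symm [IsManifold 𝓘(ℝ, ℂ) ∞ S] (x₀ : S) {y : ℂ}
    (hy : y ∈ (extChartAt 𝓘(ℝ, ℂ) x₀).target) {f : S → F}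
    (hf : MDifferentiableAt 𝓘(ℝ, ℂ) 𝓘(ℝ, F) f ((extChartAt 𝓘(ℝ, ℂ) x₀).symm y)) (v : ℂ) :
    fderiv ℝ (f ∘ (extChartAt 𝓘(ℝ, ℂ) x₀).symm) y v
      = diff f ((extChartAt 𝓘(ℝ, ℂ) x₀).symm y)
        (chartSymmDeriv x₀ y v) := by
  have h := (hasFDerivAt_comp_chart_symm x₀ hy (A := (diff f _ : ℂ →L[ℝ] F))
    hf.hasMFDerivAt).fderiv
  exact congrArg (fun B : ℂ →L[ℝ] F => B v) h

/-- In the preferred chart at `x`, the derivative at `x` is the derivative of the representative. -/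
theorem diff_eq_fderiv {f : S → F} {x : S} (hf : MDifferentiableAt 𝓘(ℝ, ℂ) 𝓘(ℝ, F) f x) :
    diff f x = fderiv ℝ (f ∘ (extChartAt 𝓘(ℝ, ℂ) x).symm) (extChartAt 𝓘(ℝ, ℂ) x x) := by
  rw [diff, hf.mfderiv]
  simp [writtenInExtChartAt]
  rfl

theorem contDiffOn_comp_chart_symm [IsManifold 𝓘(ℝ, ℂ) ∞ S] (x₀ : S) {f : S → F}
    (hf : ContMDiff 𝓘(ℝ, ℂ) 𝓘(ℝ, F) ∞ f) :
    ContDiffOn ℝ ∞ (f ∘ (extChartAt 𝓘(ℝ, ℂ) x₀).symm) (extChartAt 𝓘(ℝ, ℂ) x₀).target :=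
  contMDiffOn_iff_contDiffOn.1 (hf.comp_contMDiffOn (contMDiffOn_extChartAt_symm x₀))

theorem contMDiff_of_contDiffOn_comp_chart_symm [IsManifold 𝓘(ℝ, ℂ) ∞ S] {f : S → F}
    (hf : ∀ x₀, ContDiffOn ℝ ∞ (f ∘ (extChartAt 𝓘(ℝ, ℂ) x₀).symm)
      (extChartAt 𝓘(ℝ, ℂ) x₀).target) : ContMDiff 𝓘(ℝ, ℂ) 𝓘(ℝ, F) ∞ f := by
  intro x
  have h1 := ((hf x).contDiffAt (extChartAt_target_mem_nhds (I := 𝓘(ℝ, ℂ)) x)).contMDiffAt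
  have h2 := h1.comp x (contMDiffAt_extChartAt (n := ∞) (I := 𝓘(ℝ, ℂ)) (x := x))
  refine h2.congr_of_eventuallyEq ?_
  filter_upwards [extChartAt_source_mem_nhds (I := 𝓘(ℝ, ℂ)) x] with z hz
  exact congrArg f ((extChartAt 𝓘(ℝ, ℂ) x).left_inv hz).symm

/-- The inverse chart is holomorphic, so its real derivative is the restriction of scalars of a
complex linear map. -/
theorem mfderiv_chart_symm_I_mul [IsManifold 𝓘(ℂ) ω S] (x₀ : S) {y : ℂ}
    (hy : y ∈ (extChartAt 𝓘(ℝ, ℂ) x₀).target) (v : ℂ) :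
    chartSymmDeriv x₀ y (Complex.I * v)
      = J ((extChartAt 𝓘(ℝ, ℂ) x₀).symm y) (chartSymmDeriv x₀ y v) := by
  have hy' : y ∈ (extChartAt 𝓘(ℂ) x₀).target := hy
  have h1 : MDifferentiableAt 𝓘(ℂ) 𝓘(ℂ) (extChartAt 𝓘(ℂ) x₀).symm y :=
    ((contMDiffOn_extChartAt_symm (n := ω) x₀).contMDiffAt
      ((isOpen_extChartAt_target x₀).mem_nhds hy')).mdifferentiableAt (by simp)
  have h2 := (hasMFDerivAt_restrictScalars h1.hasMFDerivAt).mfderiv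
  change chartSymmDeriv x₀ y = _ at h2
  rw [h2]
  exact ContinuousLinearMap.map_smul (mfderiv 𝓘(ℂ) 𝓘(ℂ) (extChartAt 𝓘(ℂ) x₀).symm y : ℂ →L[ℂ] ℂ)
    Complex.I v

theorem mfderiv_chart_symm_comp_mfderiv_chart [IsManifold 𝓘(ℝ, ℂ) ∞ S] (x₀ : S) {y : ℂ}
    (hy : y ∈ (extChartAt 𝓘(ℝ, ℂ) x₀).target) (v : ℂ) :
    chartSymmDeriv x₀ y
      (chartDeriv x₀ y v) = v := by
  have := mfderivWithin_extChartAt_symm_comp_mfderiv_extChartAt (I := 𝓘(ℝ, ℂ)) hy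
  simp only [modelWithCornersSelf_coe, Set.range_id, mfderivWithin_univ] at this
  exact congrArg (fun A : ℂ →L[ℝ] ℂ => A v) this

theorem mfderiv_chart_comp_mfderiv_chart_symm [IsManifold 𝓘(ℝ, ℂ) ∞ S] (x₀ : S) {y : ℂ}
    (hy : y ∈ (extChartAt 𝓘(ℝ, ℂ) x₀).target) (v : ℂ) :
    chartDeriv x₀ y
      (chartSymmDeriv x₀ y v) = v := by
  have := mfderiv_extChartAt_comp_mfderivWithin_extChartAt_symm (I := 𝓘(ℝ, ℂ)) hy
  simp only [modelWithCornersSelf_coe, Set.range_id, mfderivWithin_univ] at this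
  exact congrArg (fun A : ℂ →L[ℝ] ℂ => A v) this

/-- The coordinate expression of a vector field `w` in the preferred chart at `x₀`. -/
def localField (w : ∀ x : S, TangentSpace 𝓘(ℂ) x) (x₀ : S) (y : ℂ) : ℂ :=
  chartDeriv x₀ y (w ((extChartAt 𝓘(ℝ, ℂ) x₀).symm y))

/-- The tangent bundle trivialization at `x₀` acts on fibres by the derivative of the chart, so
`localField` is the holomorphic section read in that trivialization. -/
theorem IsHolomorphicVectorField.differentiableAt_localField [IsManifold 𝓘(ℂ) ω S]
    {w : ∀ x : S, TangentSpace 𝓘(ℂ) x} (hw : IsHolomorphicVectorField w) (x₀ : S) {y : ℂ}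
    (hy : y ∈ (extChartAt 𝓘(ℝ, ℂ) x₀).target) : DifferentiableAt ℂ (localField w x₀) y := by
  set c := extChartAt 𝓘(ℂ) x₀ with hc
  have hx : c.symm y ∈ (chartAt ℂ x₀).source := by
    rw [← extChartAt_source 𝓘(ℂ)]
    exact c.map_target hy
  have h0 := hw (c.symm y)
  have h1 := ((trivializationAt ℂ (TangentSpace 𝓘(ℂ) : S → Type _)
    x₀).mdifferentiableAt_section_iff 𝓘(ℂ) w (by simpa using hx)).1 h0
  have hy' : y ∈ c.target := hy
  have hs : MDifferentiableAt 𝓘(ℂ) 𝓘(ℂ) c.symm y :=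
    ((contMDiffOn_extChartAt_symm (n := ω) x₀).contMDiffAt
      ((isOpen_extChartAt_target x₀).mem_nhds hy')).mdifferentiableAt (by simp)
  have h2 := (h1.comp y hs).differentiableAt
  refine h2.congr_of_eventuallyEq ?_
  filter_upwards [(isOpen_extChartAt_target (I := 𝓘(ℂ)) x₀).mem_nhds hy] with z hz
  have hz' : c.symm z ∈ (chartAt ℂ x₀).source := by
    rw [← extChartAt_source 𝓘(ℂ)]
    exact c.map_target hz
  have h3 := TangentBundle.continuousLinearMapAt_trivializationAt (I := 𝓘(ℂ)) hz'
  have h4 : MDifferentiableAt 𝓘(ℂ) 𝓘(ℂ) c (c.symm z) := mdifferentiableAt_extChartAt hz'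
  have h5 := (hasMFDerivAt_restrictScalars h4.hasMFDerivAt).mfderiv
  have h6 := congrFun ((trivializationAt ℂ (TangentSpace 𝓘(ℂ) : S → Type _)
    x₀).continuousLinearMapAt_apply ℂ (c.symm z)) (w (c.symm z))
  rw [Bundle.Trivialization.coe_linearMapAt_of_mem _ (by simpa using hz')] at h6
  change (mfderiv 𝓘(ℝ, ℂ) 𝓘(ℝ, ℂ) c (c.symm z) : ℂ →L[ℝ] ℂ) (w (c.symm z)) = _
  rw [h5]
  change (mfderiv 𝓘(ℂ) 𝓘(ℂ) c (c.symm z) : ℂ →L[ℂ] ℂ) (w (c.symm z)) = _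
  rw [← h3]
  exact h6

end

/-! ### Tangent planes of ruled maps, and the cone equations on the surface. -/

section

variable {S : Type*} [TopologicalSpace S] [ChartedSpace ℂ S] {φ ψ : S → C3}

theorem isImmersedAt_ruledMap_iff {x : S} {A B : ℂ →L[ℝ] C3}
    (hA : HasMFDerivAt 𝓘(ℝ, ℂ) 𝓘(ℝ, C3) φ x A) (hB : HasMFDerivAt 𝓘(ℝ, ℂ) 𝓘(ℝ, C3) ψ x B)
    (r : ℝ) : IsImmersedAt (𝓘(ℝ, ℂ).prod 𝓘(ℝ, ℝ)) (ruledMap φ ψ) (x, r) ↔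
      ∀ (v : ℂ) (t : ℝ), t • φ x + (r • A v + B v) = 0 → v = 0 ∧ t = 0 := by
  have h := (hasMFDerivAt_ruledMap hA hB r).mfderiv
  rw [IsImmersedAt, h]
  refine (injective_iff_map_eq_zero ((ContinuousLinearMap.snd ℝ ℂ ℝ).smulRight (φ x)
        + (r • A + B).comp (ContinuousLinearMap.fst ℝ ℂ ℝ) : ℂ × ℝ →L[ℝ] C3)).trans ?_
  simp [Prod.forall, Prod.ext_iff]

theorem mem_tangentPlane_ruledMap_iff {x : S} {A B : ℂ →L[ℝ] C3}
    (hA : HasMFDerivAt 𝓘(ℝ, ℂ) 𝓘(ℝ, C3) φ x A) (hB : HasMFDerivAt 𝓘(ℝ, ℂ) 𝓘(ℝ, C3) ψ x B)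
    (r : ℝ) (z : C3) : z ∈ tangentPlane (𝓘(ℝ, ℂ).prod 𝓘(ℝ, ℝ)) (ruledMap φ ψ) (x, r) ↔
      ∃ (v : ℂ) (t : ℝ), t • φ x + (r • A v + B v) = z := by
  have h := (hasMFDerivAt_ruledMap hA hB r).mfderiv
  rw [tangentPlane, h]
  refine (LinearMap.mem_range (f := ((ContinuousLinearMap.snd ℝ ℂ ℝ).smulRight (φ x)
        + (r • A + B).comp (ContinuousLinearMap.fst ℝ ℂ ℝ) : ℂ × ℝ →L[ℝ] C3).toLinearMap)).trans ?_
  simp [Prod.exists]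

theorem IsROrientedSLCone.inner_self (hφ : IsROrientedSLCone φ) (x : S) :
    inner ℝ (φ x) (φ x) = (1 : ℝ) := by
  rw [real_inner_self_eq_norm_sq, hφ.norm_eq_one]; norm_num

theorem IsROrientedSLCone.mdifferentiableAt (hφ : IsROrientedSLCone φ) (x : S) :
    MDifferentiableAt 𝓘(ℝ, ℂ) 𝓘(ℝ, C3) φ x :=
  hφ.smooth.mdifferentiable (by simp) x

/-- The derivative of the constant |φ|² = 1, computed in the preferred chart. -/
theorem IsROrientedSLCone.inner_diff (hφ : IsROrientedSLCone φ) (x : S)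
    (v : TangentSpace 𝓘(ℝ, ℂ) x) : inner ℝ (φ x) (diff φ x v) = (0 : ℝ) := by
  have h1 := hφ.mdifferentiableAt x
  have h2 : DifferentiableAt ℝ (φ ∘ (extChartAt 𝓘(ℝ, ℂ) x).symm) (extChartAt 𝓘(ℝ, ℂ) x x) := by
    have := h1.differentiableWithinAt_writtenInExtChartAt
    rw [modelWithCornersSelf_coe, Set.range_id, differentiableWithinAt_univ] at this
    exact this
  have h3 := h2.hasFDerivAt.inner ℝ h2.hasFDerivAt
  have h4 := h3.unique ((hasFDerivAt_const (1 : ℝ) _).congr_of_eventuallyEq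
    (Filter.Eventually.of_forall fun z => hφ.inner_self _))
  have h5 := congrArg (fun A : ℂ →L[ℝ] ℝ => A v) h4
  have h6 : (φ ∘ (extChartAt 𝓘(ℝ, ℂ) x).symm) (extChartAt 𝓘(ℝ, ℂ) x x) = φ x :=
    congrArg φ (extChartAt_to_inv x)
  simp only [h6] at h5
  have h7 : inner ℝ (φ x) (fderiv ℝ (φ ∘ (extChartAt 𝓘(ℝ, ℂ) x).symm)
      (extChartAt 𝓘(ℝ, ℂ) x x) v) + inner ℝ (fderiv ℝ (φ ∘ (extChartAt 𝓘(ℝ, ℂ) x).symm)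
      (extChartAt 𝓘(ℝ, ℂ) x x) v) (φ x) = (0 : ℝ) := h5
  have h8 := real_inner_comm (φ x) (fderiv ℝ (φ ∘ (extChartAt 𝓘(ℝ, ℂ) x).symm)
      (extChartAt 𝓘(ℝ, ℂ) x x) v)
  rw [h8] at h7
  rw [diff_eq_fderiv h1]
  exact self_eq_neg.1 (eq_neg_of_add_eq_zero_left h7)

theorem IsROrientedSLCone.diff_ne_zero (hφ : IsROrientedSLCone φ) (x : S)
    {v : TangentSpace 𝓘(ℝ, ℂ) x} (hv : v ≠ 0) : diff φ x v ≠ 0 := fun h =>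
  hv (hφ.immersed x (h.trans (map_zero (diff φ x)).symm))

/-- The tangent planes of a special Lagrangian cone are closed under the cross product. -/
theorem IsROrientedSLCone.cross_diff (hφ : IsROrientedSLCone φ)
    (hJ : IsInducedComplexStructure φ) (x : S) (v : TangentSpace 𝓘(ℝ, ℂ) x) :
    cross (φ x) (diff φ x v) = diff φ x (J x v) ∧
      cross (diff φ x v) (diff φ x (J x v)) = (inner ℝ (diff φ x v) (diff φ x v) : ℝ) • φ x := by
  by_cases hv : v = 0
  · subst hv
    simp
  obtain ⟨A, hAe⟩ : ∃ A : ℂ →L[ℝ] C3, A = diff φ x := ⟨_, rfl⟩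
  have hA : HasMFDerivAt 𝓘(ℝ, ℂ) 𝓘(ℝ, C3) φ x A :=
    hAe ▸ (hφ.mdifferentiableAt x).hasMFDerivAt
  have hB : HasMFDerivAt 𝓘(ℝ, ℂ) 𝓘(ℝ, C3) (0 : S → C3) x (0 : ℂ →L[ℝ] C3) :=
    hasMFDerivAt_const (0 : C3) x
  have hA0 : ∀ u : ℂ, inner ℝ (φ x) (A u) = (0 : ℝ) := fun u => hAe ▸ hφ.inner_diff x u
  -- At r = 1 the tangent plane of the cone is the orthogonal sum of the line of φ and the image of
  -- dφ.
  have himm : IsImmersedAt (𝓘(ℝ, ℂ).prod 𝓘(ℝ, ℝ)) (ruledMap φ 0) (x, (1 : ℝ)) := by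
    refine (isImmersedAt_ruledMap_iff hA hB 1).2 fun u t h => ?_
    have h1 := congrArg (fun z => inner ℝ (φ x) z) h
    simp only [one_smul, zero_apply, add_zero, inner_add_right, inner_smul_right, hA0,
      hφ.inner_self, mul_one, inner_zero_right] at h1
    rw [h1] at h
    simp only [zero_smul, one_smul, zero_apply, add_zero, zero_add] at h
    refine ⟨?_, h1⟩
    by_contra hu
    exact hφ.diff_ne_zero x (v := (u : ℂ)) hu (by rw [← hAe]; exact h)
  obtain ⟨o, -, hcal⟩ := hφ.ruledSL.specialLagrangian.calibrated
  have hmem := mem_tangentPlane_ruledMap_iff hA hB 1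
  have hmem' : ∀ u : ℂ, A u ∈ tangentPlane (𝓘(ℝ, ℂ).prod 𝓘(ℝ, ℝ)) (ruledMap φ 0) (x, (1 : ℝ)) :=
    fun u => (hmem _).2 ⟨u, 0, by simp⟩
  rw [hAe] at hmem'
  have h1 := (hcal _ himm).abs_reOmega ((hmem (φ x)).2 ⟨0, 1, by simp⟩) (hmem' v) (hmem' (J x v))
    (hφ.inner_diff x v) (hφ.inner_diff x _) (hJ.orthogonal x v)
  replace h1 : |reOmega ![φ x, diff φ x v, diff φ x (J x v)]|
    = ‖φ x‖ * ‖diff φ x v‖ * ‖diff φ x (J x v)‖ := h1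
  have h2 := hJ.oriented x v hv
  have h3 := hJ.isometry x v
  rw [inducedMetric, inducedMetric] at h3
  have h4 : ‖diff φ x (J x v)‖ = ‖diff φ x v‖ := by
    rw [norm_eq_sqrt_real_inner, h3, ← norm_eq_sqrt_real_inner]
  -- Positivity on the oriented frame (φ, dφ(v), dφ(Jv)) removes the absolute value, which leaves
  -- the equality case of Re Ω ≤ vol.
  rw [abs_of_pos h2, h4, hφ.norm_eq_one, one_mul, ← sq, ← real_inner_self_eq_norm_sq,
    reOmega_eq] at h1
  exact ⟨(eq_cross_of_calibrated (hφ.inner_self x) h3.symm (h1.trans h3.symm)).symm,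
    cross_eq_smul_of_calibrated (hφ.inner_self x) rfl h3 h1⟩

theorem IsROrientedSLCone.isLocalCone [IsManifold 𝓘(ℂ) ω S] [IsManifold 𝓘(ℝ, ℂ) ∞ S]
    (hφ : IsROrientedSLCone φ) (hJ : IsInducedComplexStructure φ) (x₀ : S) :
    IsLocalCone (extChartAt 𝓘(ℝ, ℂ) x₀).target (φ ∘ (extChartAt 𝓘(ℝ, ℂ) x₀).symm) where
  isOpen := isOpen_extChartAt_target x₀
  smooth := contDiffOn_comp_chart_symm x₀ hφ.smooth
  cross_eq := fun y hy v => by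
    rw [fderiv_comp_chart_symm x₀ hy (hφ.mdifferentiableAt _),
      fderiv_comp_chart_symm x₀ hy (hφ.mdifferentiableAt _), mfderiv_chart_symm_I_mul x₀ hy]
    exact (hφ.cross_diff hJ _ _).1
  cross_deriv := fun y hy => by
    rw [fderiv_comp_chart_symm x₀ hy (hφ.mdifferentiableAt _),
      fderiv_comp_chart_symm x₀ hy (hφ.mdifferentiableAt _), ← mul_one Complex.I,
      mfderiv_chart_symm_I_mul x₀ hy]
    exact (hφ.cross_diff hJ _ _).2

/-! ### Closedness of β on the surface. -/

/-- The coordinate expression of a `1`-form in the preferred chart at `x₀`. -/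
def localForm {F : Type*} [NormedAddCommGroup F] [NormedSpace ℝ F]
    (α : ∀ x : S, TangentSpace 𝓘(ℝ, ℂ) x →L[ℝ] F) (x₀ : S) (y : ℂ) : ℂ →L[ℝ] F :=
  (α ((extChartAt 𝓘(ℝ, ℂ) x₀).symm y) : ℂ →L[ℝ] F).comp (chartSymmDeriv x₀ y)

theorem extD_eq {F : Type*} [NormedAddCommGroup F] [NormedSpace ℝ F]
    (α : ∀ x : S, TangentSpace 𝓘(ℝ, ℂ) x →L[ℝ] F) (x : S) (u v : ℂ) :
    extD α x u v = fderiv ℝ (localForm α x) (extChartAt 𝓘(ℝ, ℂ) x x) u v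
      - fderiv ℝ (localForm α x) (extChartAt 𝓘(ℝ, ℂ) x x) v u := rfl

theorem localForm_starOne_diff [IsManifold 𝓘(ℂ) ω S] [IsManifold 𝓘(ℝ, ℂ) ∞ S]
    {F : Type*} [NormedAddCommGroup F] [NormedSpace ℝ F]
    {f : S → F} (hf : ContMDiff 𝓘(ℝ, ℂ) 𝓘(ℝ, F) ∞ f) (x₀ : S) {y : ℂ}
    (hy : y ∈ (extChartAt 𝓘(ℝ, ℂ) x₀).target) :
    localForm (starOne (diff f)) x₀ y
      = -(fderiv ℝ (f ∘ (extChartAt 𝓘(ℝ, ℂ) x₀).symm) y).comp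
        (ContinuousLinearMap.mul ℝ ℂ Complex.I) := by
  ext1 v
  change -(diff f _ (J _ (chartSymmDeriv x₀ y v)))
    = -(fderiv ℝ (f ∘ (extChartAt 𝓘(ℝ, ℂ) x₀).symm) y (Complex.I * v))
  rw [fderiv_comp_chart_symm x₀ hy (hf.mdifferentiable (by simp) _),
    mfderiv_chart_symm_I_mul x₀ hy]

theorem localForm_bryantForm [IsManifold 𝓘(ℂ) ω S] [IsManifold 𝓘(ℝ, ℂ) ∞ S] {ρ : S → ℝ}
    (hφ : ContMDiff 𝓘(ℝ, ℂ) 𝓘(ℝ, C3) ∞ φ) (hρ : ContMDiff 𝓘(ℝ, ℂ) 𝓘(ℝ, ℝ) ∞ ρ) (x₀ : S) {y : ℂ}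
    (hy : y ∈ (extChartAt 𝓘(ℝ, ℂ) x₀).target) :
    localForm (bryantForm φ ρ) x₀ y = localBryantForm (φ ∘ (extChartAt 𝓘(ℝ, ℂ) x₀).symm)
      (ρ ∘ (extChartAt 𝓘(ℝ, ℂ) x₀).symm) y := by
  rw [localBryantForm, ← localForm_starOne_diff hφ x₀ hy, ← localForm_starOne_diff hρ x₀ hy]
  rfl

/-- In a conformal coordinate *d* d is the flat Laplacian divided by the conformal factor |∂ₛφ|².
The identity is obtained only at the centre of a preferred chart, where `extD` and `starTwo` are
evaluated. -/
theorem laplace_equation_of_starDStarD [IsManifold 𝓘(ℂ) ω S] [IsManifold 𝓘(ℝ, ℂ) ∞ S] {ρ : S → ℝ}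
    (hφ : IsROrientedSLCone φ) (hJ : IsInducedComplexStructure φ)
    (hρ : ContMDiff 𝓘(ℝ, ℂ) 𝓘(ℝ, ℝ) ∞ ρ) (x : S) (h : starDStarD φ ρ x + 2 * ρ x = 0) :
    fderiv ℝ (fderiv ℝ (ρ ∘ (extChartAt 𝓘(ℝ, ℂ) x).symm)) (extChartAt 𝓘(ℝ, ℂ) x x) 1 1
      + fderiv ℝ (fderiv ℝ (ρ ∘ (extChartAt 𝓘(ℝ, ℂ) x).symm)) (extChartAt 𝓘(ℝ, ℂ) x x)
        Complex.I Complex.I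
      + 2 * inner ℝ (fderiv ℝ (φ ∘ (extChartAt 𝓘(ℝ, ℂ) x).symm) (extChartAt 𝓘(ℝ, ℂ) x x) 1)
        (fderiv ℝ (φ ∘ (extChartAt 𝓘(ℝ, ℂ) x).symm) (extChartAt 𝓘(ℝ, ℂ) x x) 1)
        * (ρ ∘ (extChartAt 𝓘(ℝ, ℂ) x).symm) (extChartAt 𝓘(ℝ, ℂ) x x) = 0 := by
  set c := extChartAt 𝓘(ℝ, ℂ) x with hc
  have hT : IsOpen c.target := isOpen_extChartAt_target x
  have hx : c x ∈ c.target := mem_extChartAt_target x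
  have hsm : ContDiffOn ℝ ∞ (ρ ∘ c.symm) c.target := contDiffOn_comp_chart_symm x hρ
  have h1 : HasFDerivAt (localForm (starOne (diff ρ)) x)
      ((ContinuousLinearMap.compL ℝ ℂ ℂ ℝ).flip (-(ContinuousLinearMap.mul ℝ ℂ Complex.I)) ∘L
        fderiv ℝ (fderiv ℝ (ρ ∘ c.symm)) (c x)) (c x) := by
    have h2 := hasFDerivAt_of_smooth hT (contDiffOn_fderiv_of_smooth hT hsm) hx
    refine (((ContinuousLinearMap.compL ℝ ℂ ℂ ℝ).flip
      (-(ContinuousLinearMap.mul ℝ ℂ Complex.I))).hasFDerivAt.comp (c x) h2).congr_of_eventuallyEq ?_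
    filter_upwards [hT.mem_nhds hx] with y hy
    rw [localForm_starOne_diff hρ x hy]
    exact (ContinuousLinearMap.comp_neg _ _).symm
  have h2 : extD (starOne (diff ρ)) x (1 : ℂ) Complex.I
      = fderiv ℝ (fderiv ℝ (ρ ∘ c.symm)) (c x) 1 1
        + fderiv ℝ (fderiv ℝ (ρ ∘ c.symm)) (c x) Complex.I Complex.I := by
    rw [extD_eq, h1.fderiv]
    simp [add_comm]
  have h3 : diff φ x (1 : ℂ) = fderiv ℝ (φ ∘ c.symm) (c x) 1 := by
    rw [diff_eq_fderiv (hφ.mdifferentiableAt x)]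
    rfl
  have h4 : areaForm φ x (1 : ℂ) Complex.I
      = inner ℝ (fderiv ℝ (φ ∘ c.symm) (c x) 1) (fderiv ℝ (φ ∘ c.symm) (c x) 1) := by
    rw [← h3]
    have h5 := hJ.isometry x (1 : ℂ)
    have h6 : J x (1 : ℂ) = (Complex.I : ℂ) := mul_one Complex.I
    rw [h6] at h5
    change inducedMetric φ x (J x (1 : ℂ)) Complex.I = _
    rw [h6]
    exact h5
  have h5 : (0 : ℝ) < inner ℝ (fderiv ℝ (φ ∘ c.symm) (c x) 1) (fderiv ℝ (φ ∘ c.symm) (c x) 1) := by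
    rw [← h3]
    exact real_inner_self_pos.2 (hφ.diff_ne_zero x (one_ne_zero (α := ℂ)))
  have h6 : (ρ ∘ c.symm) (c x) = ρ x := congrArg ρ (extChartAt_to_inv x)
  rw [starDStarD, starTwo, h2, h4] at h
  rw [h6]
  field_simp at h
  linarith

theorem contDiffAt_transition [IsManifold 𝓘(ℝ, ℂ) ∞ S] (x₀ x : S) {y : ℂ}
    (hy : y ∈ (extChartAt 𝓘(ℝ, ℂ) x₀).target)
    (hyx : (extChartAt 𝓘(ℝ, ℂ) x₀).symm y ∈ (extChartAt 𝓘(ℝ, ℂ) x).source) :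
    ContDiffAt ℝ ∞ (extChartAt 𝓘(ℝ, ℂ) x ∘ (extChartAt 𝓘(ℝ, ℂ) x₀).symm) y := by
  have h1 := (contMDiffOn_extChartAt_symm (I := 𝓘(ℝ, ℂ)) (n := ∞) x₀).contMDiffAt
    ((isOpen_extChartAt_target x₀).mem_nhds hy)
  have h2 := contMDiffAt_extChartAt' (I := 𝓘(ℝ, ℂ)) (n := ∞) (x := x)
    (by rwa [extChartAt_source] at hyx)
  exact (h2.comp y h1).contDiffAt

theorem localForm_transition [IsManifold 𝓘(ℝ, ℂ) ∞ S] {F : Type*} [NormedAddCommGroup F]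
    [NormedSpace ℝ F] (α : ∀ x : S, TangentSpace 𝓘(ℝ, ℂ) x →L[ℝ] F) (x₀ x : S) {y : ℂ}
    (hy : y ∈ (extChartAt 𝓘(ℝ, ℂ) x₀).target)
    (hyx : (extChartAt 𝓘(ℝ, ℂ) x₀).symm y ∈ (extChartAt 𝓘(ℝ, ℂ) x).source) :
    localForm α x₀ y
      = (localForm α x ((extChartAt 𝓘(ℝ, ℂ) x ∘ (extChartAt 𝓘(ℝ, ℂ) x₀).symm) y)).comp
        (fderiv ℝ (extChartAt 𝓘(ℝ, ℂ) x ∘ (extChartAt 𝓘(ℝ, ℂ) x₀).symm) y) := by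
  set c₀ := extChartAt 𝓘(ℝ, ℂ) x₀ with hc₀
  set c := extChartAt 𝓘(ℝ, ℂ) x with hc
  have e : c.symm ((c ∘ c₀.symm) y) = c₀.symm y := c.left_inv hyx
  have hτ := ((contDiffAt_transition x₀ x hy hyx).differentiableAt (by simp)).hasFDerivAt
  have h1 : HasMFDerivAt 𝓘(ℝ, ℂ) 𝓘(ℝ, ℂ) c.symm ((c ∘ c₀.symm) y)
      (chartSymmDeriv x ((c ∘ c₀.symm) y)) :=
    (mdifferentiableAt_chart_symm x (c.map_source hyx)).hasMFDerivAt
  have h2 := HasMFDerivAt.comp y h1 hτ.hasMFDerivAt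
  have h3 : c₀.symm =ᶠ[𝓝 y] c.symm ∘ (c ∘ c₀.symm) := by
    filter_upwards [(mdifferentiableAt_chart_symm x₀ hy).continuousAt.eventually
      ((isOpen_extChartAt_source x).mem_nhds hyx)] with z hz using (c.left_inv hz).symm
  have h4 : chartSymmDeriv x₀ y
      = (chartSymmDeriv x ((c ∘ c₀.symm) y)).comp (fderiv ℝ (c ∘ c₀.symm) y) :=
    (h2.congr_of_eventuallyEq h3).mfderiv
  obtain ⟨a, ha⟩ : ∃ a : S → ℂ →L[ℝ] F, a = fun x => α x := ⟨_, rfl⟩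
  have h5 : (a (c₀.symm y)).comp (chartSymmDeriv x₀ y)
      = ((a (c.symm ((c ∘ c₀.symm) y))).comp (chartSymmDeriv x ((c ∘ c₀.symm) y))).comp
        (fderiv ℝ (c ∘ c₀.symm) y) := by
    rw [e, h4, ContinuousLinearMap.comp_assoc]
  rw [ha] at h5
  exact h5

/-- The Bryant form is closed, in every chart. -/
theorem localForm_bryantForm_closed [IsManifold 𝓘(ℂ) ω S] [IsManifold 𝓘(ℝ, ℂ) ∞ S] {ρ : S → ℝ}
    (hφ : IsROrientedSLCone φ) (hJ : IsInducedComplexStructure φ)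
    (hρ : ContMDiff 𝓘(ℝ, ℂ) 𝓘(ℝ, ℝ) ∞ ρ) (h : ∀ x, starDStarD φ ρ x + 2 * ρ x = 0) (x₀ : S) {y : ℂ}
    (hy : y ∈ (extChartAt 𝓘(ℝ, ℂ) x₀).target) (u v : ℂ) :
    fderiv ℝ (localForm (bryantForm φ ρ) x₀) y u v
      = fderiv ℝ (localForm (bryantForm φ ρ) x₀) y v u := by
  -- The Laplace equation is at hand at `x` in the preferred chart of `x` itself; closedness is
  -- proved there and pulled back to the chart at `x₀`.
  set x := (extChartAt 𝓘(ℝ, ℂ) x₀).symm y with hx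
  set c := extChartAt 𝓘(ℝ, ℂ) x with hc
  have hT : IsOpen c.target := isOpen_extChartAt_target x
  have hcx : c x ∈ c.target := mem_extChartAt_target x
  have hxs : x ∈ c.source := mem_extChartAt_source x
  have heq : localForm (bryantForm φ ρ) x =ᶠ[𝓝 (c x)] localBryantForm (φ ∘ c.symm) (ρ ∘ c.symm) := by
    filter_upwards [hT.mem_nhds hcx] with z hz using localForm_bryantForm hφ.smooth hρ x hz
  have hρ' : ContDiffOn ℝ ∞ (ρ ∘ c.symm) c.target := contDiffOn_comp_chart_symm x hρ
  have hcone := hφ.isLocalCone hJ x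
  have hcl := hcone.localBryantForm_closed hρ' hcx
    (laplace_equation_of_starDStarD hφ hJ hρ x (h x))
  have hdiff := (hasFDerivAt_of_smooth hT (contDiffOn_localBryantForm hT hcone.smooth hρ')
    hcx).differentiableAt
  refine fderiv_symm_of_pullback (a := localForm (bryantForm φ ρ) x)
    (contDiffAt_transition x₀ x hy hxs) (hdiff.congr_of_eventuallyEq heq) ?_ ?_ u v
  · intro u v
    change fderiv ℝ (localForm (bryantForm φ ρ) x) (c x) u v
      = fderiv ℝ (localForm (bryantForm φ ρ) x) (c x) v u
    rw [heq.fderiv_eq]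
    exact hcl u v
  · have h1 : ∀ᶠ z in 𝓝 y, z ∈ (extChartAt 𝓘(ℝ, ℂ) x₀).target :=
      (isOpen_extChartAt_target x₀).mem_nhds hy
    have h2 : ∀ᶠ z in 𝓝 y, (extChartAt 𝓘(ℝ, ℂ) x₀).symm z ∈ c.source :=
      (mdifferentiableAt_chart_symm x₀ hy).continuousAt.eventually
        ((isOpen_extChartAt_source x).mem_nhds hxs)
    filter_upwards [h1, h2] with z hz1 hz2 using localForm_transition _ x₀ x hz1 hz2

end

/-! ### Global primitives, and frames of the tangent planes. -/

section

variable {S : Type*} [TopologicalSpace S] [ChartedSpace ℂ S] {F : Type*} [NormedAddCommGroup F]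
  [NormedSpace ℝ F]

/-- A function with vanishing derivative is locally constant. -/
theorem eventually_eq_of_hasMFDerivAt_zero [IsManifold 𝓘(ℝ, ℂ) ∞ S] {h : S → F} {x : S}
    (hh : ∀ᶠ y in 𝓝 x, HasMFDerivAt 𝓘(ℝ, ℂ) 𝓘(ℝ, F) h y (0 : ℂ →L[ℝ] F)) :
    ∀ᶠ y in 𝓝 x, h y = h x := by
  set c := extChartAt 𝓘(ℝ, ℂ) x with hc
  have hcx : c x ∈ c.target := mem_extChartAt_target x
  have h1 : ∀ᶠ z in 𝓝 (c x), z ∈ c.target := (isOpen_extChartAt_target x).mem_nhds hcx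
  have h2 : ∀ᶠ z in 𝓝 (c x), HasMFDerivAt 𝓘(ℝ, ℂ) 𝓘(ℝ, F) h (c.symm z) (0 : ℂ →L[ℝ] F) := by
    have h3 := (mdifferentiableAt_chart_symm x hcx).continuousAt
    rw [ContinuousAt, extChartAt_to_inv] at h3
    exact h3.eventually hh
  obtain ⟨ε, hε, hball⟩ := Metric.eventually_nhds_iff_ball.1 (h1.and h2)
  have hd : ∀ z ∈ Metric.ball (c x) ε, HasFDerivAt (h ∘ c.symm) (0 : ℂ →L[ℝ] F) z := fun z hz => by
    have := hasFDerivAt_comp_chart_symm x (hball z hz).1 (hball z hz).2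
    rwa [ContinuousLinearMap.zero_comp] at this
  have hconst : ∀ z ∈ Metric.ball (c x) ε, (h ∘ c.symm) z = (h ∘ c.symm) (c x) := fun z hz =>
    Metric.isOpen_ball.is_const_of_fderiv_eq_zero (𝕜 := ℝ)
      (convex_ball (c x) ε).isPreconnected
      (fun y hy => (hd y hy).differentiableAt.differentiableWithinAt)
      (fun y hy => (hd y hy).fderiv) hz (Metric.mem_ball_self hε)
  filter_upwards [extChartAt_source_mem_nhds (I := 𝓘(ℝ, ℂ)) x,
    (continuousAt_extChartAt (I := 𝓘(ℝ, ℂ)) x).eventually (Metric.ball_mem_nhds (c x) hε)]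
    with y hy1 hy2
  have := hconst (c y) hy2
  rwa [Function.comp_apply, Function.comp_apply, c.left_inv hy1, extChartAt_to_inv] at this

/-- **Poincaré lemma** on a simply connected surface, for smooth closed `1`-forms. -/
theorem exists_primitive [IsManifold 𝓘(ℝ, ℂ) ∞ S] [SimplyConnectedSpace S]
    [CompleteSpace F] (α : ∀ x : S, TangentSpace 𝓘(ℝ, ℂ) x →L[ℝ] F)
    (hα : ∀ x₀ : S, DifferentiableOn ℝ (localForm α x₀) (extChartAt 𝓘(ℝ, ℂ) x₀).target)
    (hcl : ∀ x₀ : S, ∀ y ∈ (extChartAt 𝓘(ℝ, ℂ) x₀).target, ∀ u v,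
      fderiv ℝ (localForm α x₀) y u v = fderiv ℝ (localForm α x₀) y v u) :
    ∃ b : S → F, ∀ x, HasMFDerivAt 𝓘(ℝ, ℂ) 𝓘(ℝ, F) b x (α x) := by
  have hloc : ∀ x₀ : S, ∃ U : Set S, IsOpen U ∧ x₀ ∈ U ∧ ∃ f : S → F,
      ∀ x ∈ U, HasMFDerivAt 𝓘(ℝ, ℂ) 𝓘(ℝ, F) f x (α x) := by
    intro x₀
    set c := extChartAt 𝓘(ℝ, ℂ) x₀ with hc
    obtain ⟨ε, hε, hball⟩ := Metric.isOpen_iff.1 (isOpen_extChartAt_target (I := 𝓘(ℝ, ℂ)) x₀) (c x₀)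
      (mem_extChartAt_target x₀)
    obtain ⟨g, hg⟩ := (convex_ball (c x₀) ε).exists_forall_hasFDerivAt_of_fderiv_symmetric
      Metric.isOpen_ball ((hα x₀).mono hball) (fun y hy => hcl x₀ y (hball hy))
    refine ⟨c.source ∩ c ⁻¹' Metric.ball (c x₀) ε,
      (continuousOn_extChartAt x₀).isOpen_inter_preimage (isOpen_extChartAt_source x₀)
        Metric.isOpen_ball, ⟨mem_extChartAt_source x₀, Metric.mem_ball_self hε⟩, g ∘ c, ?_⟩
    have key : ∀ y ∈ Metric.ball (c x₀) ε,
        HasMFDerivAt 𝓘(ℝ, ℂ) 𝓘(ℝ, F) (g ∘ c) (c.symm y) (α (c.symm y)) := by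
      intro y hy
      have hyT := hball hy
      have hs : c.symm y ∈ (chartAt ℂ x₀).source := by
        rw [← extChartAt_source 𝓘(ℝ, ℂ)]
        exact c.map_target hyT
      have h1 : HasMFDerivAt 𝓘(ℝ, ℂ) 𝓘(ℝ, ℂ) c (c.symm y) (chartDeriv x₀ y) :=
        (mdifferentiableAt_extChartAt hs).hasMFDerivAt
      have h2 : HasMFDerivAt 𝓘(ℝ, ℂ) 𝓘(ℝ, F) g (c (c.symm y))
          (localForm α x₀ y : ℂ →L[ℝ] F) := by
        rw [c.right_inv hyT]
        exact (hg y hy).hasMFDerivAt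
      have h3 := HasMFDerivAt.comp (c.symm y) h2 h1
      have h4 : (localForm α x₀ y).comp (chartDeriv x₀ y) = (α (c.symm y) : ℂ →L[ℝ] F) := by
        ext1 v
        exact congrArg (α (c.symm y) : ℂ →L[ℝ] F)
          (mfderiv_chart_symm_comp_mfderiv_chart x₀ hyT v)
      exact h4 ▸ h3
    rintro x ⟨hx1, hx2⟩
    have := key (c x) hx2
    rwa [c.left_inv hx1] at this
  choose U hUo hxU f hf using hloc
  have _ : LocallyPathConnectedSpace S := ChartedSpace.locallyPathConnectedSpace ℂ S
  -- Two local primitives of the same form differ by a function with zero derivative.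
  obtain ⟨b, hb⟩ := exists_global_of_locally_constant_sub U hUo id hxU f (by
    rintro i j x ⟨hi, hj⟩
    refine eventually_eq_of_hasMFDerivAt_zero (h := fun y => f i y - f j y) ?_
    filter_upwards [(hUo i).mem_nhds hi, (hUo j).mem_nhds hj] with y hyi hyj
    have := (hf i y hyi).sub (hf j y hyj)
    rw [sub_self] at this
    exact this)
  refine ⟨b, fun x => ?_⟩
  have h1 : HasMFDerivAt 𝓘(ℝ, ℂ) 𝓘(ℝ, F) (f x + fun _ => b x - f x x) x (α x) := by
    have h2 := (hf x x (hxU x)).add (hasMFDerivAt_const (I := 𝓘(ℝ, ℂ)) (b x - f x x) x)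
    have h3 : (α x : ℂ →L[ℝ] F) + 0 = α x := add_zero _
    exact h3 ▸ h2
  refine h1.congr_of_eventuallyEq ?_
  filter_upwards [hb x x (hxU x)] with y hy
  rw [Pi.add_apply, ← hy, add_sub_cancel]

/-- An oriented frame of the tangent planes of a ruled map. -/
theorem exists_basis_tangentPlane {φ ψ : S → C3} {x : S} {A B : ℂ →L[ℝ] C3}
    (hA : HasMFDerivAt 𝓘(ℝ, ℂ) 𝓘(ℝ, C3) φ x A) (hB : HasMFDerivAt 𝓘(ℝ, ℂ) 𝓘(ℝ, C3) ψ x B)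
    {r : ℝ} (himm : IsImmersedAt (𝓘(ℝ, ℂ).prod 𝓘(ℝ, ℝ)) (ruledMap φ ψ) (x, r)) {v : ℂ}
    (hv : v ≠ 0) : ∃ E : Module.Basis (Fin 3) ℝ
      (tangentPlane (𝓘(ℝ, ℂ).prod 𝓘(ℝ, ℝ)) (ruledMap φ ψ) (x, r)),
      (E 0 : C3) = φ x ∧ (E 1 : C3) = r • A v + B v ∧
      (E 2 : C3) = r • A (Complex.I * v) + B (Complex.I * v) := by
  have hmem := mem_tangentPlane_ruledMap_iff hA hB r
  rw [isImmersedAt_ruledMap_iff hA hB] at himm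
  set V := tangentPlane (𝓘(ℝ, ℂ).prod 𝓘(ℝ, ℝ)) (ruledMap φ ψ) (x, r)
  have h0 : φ x ∈ V := (hmem _).2 ⟨0, 1, by simp⟩
  have hL : ∀ u, r • A u + B u ∈ V := fun u => (hmem _).2 ⟨u, 0, by simp⟩
  have hcomb : ∀ g : Fin 3 → ℝ, g 0 • φ x + (g 1 • (r • A v + B v)
      + g 2 • (r • A (Complex.I * v) + B (Complex.I * v)))
      = g 0 • φ x + (r • A ((g 1 + g 2 * Complex.I) * v) + B ((g 1 + g 2 * Complex.I) * v)) := by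
    intro g
    have e : ((g 1 + g 2 * Complex.I) * v : ℂ) = g 1 • v + g 2 • (Complex.I * v) := by
      simp only [Complex.real_smul]; ring
    rw [e]
    simp only [map_add, map_smul]
    module
  let e : Fin 3 → V := ![⟨φ x, h0⟩, ⟨_, hL v⟩, ⟨_, hL (Complex.I * v)⟩]
  have hsum : ∀ g : Fin 3 → ℝ, ((∑ i, g i • e i : V) : C3) = g 0 • φ x
      + (r • A ((g 1 + g 2 * Complex.I) * v) + B ((g 1 + g 2 * Complex.I) * v)) := by
    intro g
    rw [← hcomb, Fin.sum_univ_three, add_assoc]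
    rfl
  have hli : LinearIndependent ℝ e := by
    rw [Fintype.linearIndependent_iff]
    intro g hg
    have h1 := congrArg (fun z : V => (z : C3)) hg
    simp only [hsum] at h1
    obtain ⟨h2, h3⟩ := himm _ _ h1
    have h4 : (g 1 + g 2 * Complex.I : ℂ) = 0 := (mul_eq_zero.1 h2).resolve_right hv
    have h5 := congrArg Complex.re h4
    have h6 := congrArg Complex.im h4
    simp at h5 h6
    intro i
    fin_cases i <;> assumption
  have hsp : ⊤ ≤ Submodule.span ℝ (Set.range e) := by
    rintro ⟨z, hz⟩ -
    obtain ⟨u, t, rfl⟩ := (hmem z).1 hz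
    rw [Submodule.mem_span_range_iff_exists_fun]
    -- Since u = (u / v) v, the real and imaginary parts of u / v are its coordinates in the real
    -- basis v, Iv of `ℂ`.
    refine ⟨![t, (u / v).re, (u / v).im], Subtype.ext ?_⟩
    rw [hsum]
    simp [Complex.re_add_im, div_mul_cancel₀ u hv]
  refine ⟨Module.Basis.mk hli hsp, ?_, ?_, ?_⟩ <;> rw [Module.Basis.mk_apply] <;> rfl

end

/-! ### From the evolution equations to special Lagrangian 3-folds. -/

section

variable {S : Type*} [TopologicalSpace S] [ChartedSpace ℂ S] {φ ψ : S → C3}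

/-- The first order system on `(φ, ψ)` that makes `(σ, r) ↦ r φ(σ) + ψ(σ)` special Lagrangian:
`A` and `B` are the derivatives of `φ` and `ψ`. -/
structure SatisfiesEvolution (φ ψ : S → C3) (A B : S → ℂ →L[ℝ] C3) : Prop where
  hasMFDerivAt_fst : ∀ x, HasMFDerivAt 𝓘(ℝ, ℂ) 𝓘(ℝ, C3) φ x (A x)
  hasMFDerivAt_snd : ∀ x, HasMFDerivAt 𝓘(ℝ, ℂ) 𝓘(ℝ, C3) ψ x (B x)
  inner_self : ∀ x, inner ℝ (φ x) (φ x) = (1 : ℝ)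
  inner_fst : ∀ x v, inner ℝ (φ x) (A x v) = (0 : ℝ)
  ne_zero : ∀ x, A x 1 ≠ 0
  cross_fst : ∀ x v, cross (φ x) (A x v) = A x (Complex.I * v)
  kahlerL_snd : ∀ x v, kahlerL (φ x) (B x v) = 0
  cross_snd : ∀ x v, ∃ c : ℝ, B x (Complex.I * v) = cross (φ x) (B x v) + c • φ x

namespace SatisfiesEvolution

variable {A B : S → ℂ →L[ℝ] C3}

theorem kahlerL_add (h : SatisfiesEvolution φ ψ A B) (x : S) (r : ℝ) (v : ℂ) :
    kahlerL (φ x) (r • A x v + B x v) = 0 := by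
  have h1 : kahlerL (φ x) (A x v) = 0 := by
    have h2 := h.cross_fst x (Complex.I * v)
    rw [clm_I_mul_I_mul] at h2
    rw [← neg_eq_zero, ← map_neg, ← h2, kahlerL_cross]
  rw [map_add, map_smul, h1, h.kahlerL_snd, smul_zero, add_zero]

theorem cross_add (h : SatisfiesEvolution φ ψ A B) (x : S) (r : ℝ) (v : ℂ) :
    ∃ c : ℝ, r • A x (Complex.I * v) + B x (Complex.I * v)
      = cross (φ x) (r • A x v + B x v) + c • φ x := by
  obtain ⟨c, hc⟩ := h.cross_snd x v
  refine ⟨c, ?_⟩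
  rw [hc, map_add, map_smul, h.cross_fst, add_assoc]

/-- If rA + B sends some v ≠ 0 into the line of φ, then by `cross_add` it does the same to Iv,
because φ × φ = 0. So it sends all of `ℂ` there, in particular 1. -/
theorem exists_eq_smul_of_not_immersed (h : SatisfiesEvolution φ ψ A B) {x : S} {r : ℝ}
    (hr : ¬ IsImmersedAt (𝓘(ℝ, ℂ).prod 𝓘(ℝ, ℝ)) (ruledMap φ ψ) (x, r)) :
    ∃ s : ℝ, r • A x 1 + B x 1 = s • φ x := by
  rw [isImmersedAt_ruledMap_iff (h.hasMFDerivAt_fst x) (h.hasMFDerivAt_snd x)] at hr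
  push Not at hr
  obtain ⟨v, t, h1, h2⟩ := hr
  have hφ : φ x ≠ 0 := fun h0 => by simpa [h0] using h.inner_self x
  have hv : v ≠ 0 := by
    rintro rfl
    have h3 := h2 rfl
    simp [h3, hφ] at h1
  obtain ⟨c, hc⟩ := h.cross_add x r v
  have h3 : r • A x v + B x v = (-t) • φ x := by
    rw [neg_smul]; exact eq_neg_of_add_eq_zero_right h1
  rw [h3, map_smul, cross_self, smul_zero, zero_add] at hc
  have e : (1 : ℂ) = (v⁻¹).re • v + (v⁻¹).im • (Complex.I * v) := by
    have h4 := Complex.re_add_im v⁻¹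
    simp only [Complex.real_smul]
    calc (1 : ℂ) = v⁻¹ * v := (inv_mul_cancel₀ hv).symm
      _ = (((v⁻¹).re : ℂ) + ((v⁻¹).im : ℂ) * Complex.I) * v := by rw [h4]
      _ = _ := by ring
  refine ⟨(v⁻¹).re * (-t) + (v⁻¹).im * c, ?_⟩
  rw [e]
  simp only [map_add, map_smul]
  calc _ = (v⁻¹).re • (r • A x v + B x v)
        + (v⁻¹).im • (r • A x (Complex.I * v) + B x (Complex.I * v)) := by
        module
    _ = _ := by rw [h3, hc]; module

/-- Each ruling line contains at most one singular point. -/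
theorem dense_immersed (h : SatisfiesEvolution φ ψ A B) :
    Dense {p : S × ℝ | IsImmersedAt (𝓘(ℝ, ℂ).prod 𝓘(ℝ, ℝ)) (ruledMap φ ψ) p} := by
  rintro ⟨x, r⟩
  have hsub : {t : ℝ | ¬ IsImmersedAt (𝓘(ℝ, ℂ).prod 𝓘(ℝ, ℝ)) (ruledMap φ ψ) (x, t)}.Subsingleton := by
    intro t₁ h₁ t₂ h₂
    obtain ⟨s₁, e₁⟩ := h.exists_eq_smul_of_not_immersed h₁
    obtain ⟨s₂, e₂⟩ := h.exists_eq_smul_of_not_immersed h₂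
    -- The term `B` drops out; `A x 1` is nonzero and orthogonal to φ, so t₁ = t₂.
    have e3 : (t₁ - t₂) • A x 1 = (s₁ - s₂) • φ x := by
      rw [sub_smul, sub_smul, ← e₁, ← e₂]; abel
    have e4 := congrArg (fun z => inner ℝ z (A x 1)) e3
    simp only [real_inner_smul_left, h.inner_fst, mul_zero] at e4
    exact sub_eq_zero.1 ((mul_eq_zero.1 e4).resolve_right (real_inner_self_pos.2 (h.ne_zero x)).ne')
  have hd : Dense {t : ℝ | ¬ IsImmersedAt (𝓘(ℝ, ℂ).prod 𝓘(ℝ, ℝ)) (ruledMap φ ψ) (x, t)}ᶜ :=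
    hsub.finite.countable.dense_compl ℝ
  exact map_mem_closure (Continuous.prodMk_right x) (hd r) fun t ht => not_not.1 ht

theorem isCalibratedPlane (h : SatisfiesEvolution φ ψ A B) (x : S) (r : ℝ) {v : ℂ}
    (E : Module.Basis (Fin 3) ℝ (tangentPlane (𝓘(ℝ, ℂ).prod 𝓘(ℝ, ℝ)) (ruledMap φ ψ) (x, r)))
    (h0 : (E 0 : C3) = φ x) (h1 : (E 1 : C3) = r • A x v + B x v)
    (h2 : (E 2 : C3) = r • A x (Complex.I * v) + B x (Complex.I * v)) :
    0 < reOmega (fun i => (E i : C3)) ∧ IsCalibratedPlane _ E.orientation := by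
  obtain ⟨c, hc⟩ := h.cross_add x r v
  exact isCalibratedPlane_of_basis E h0 h1 (h2.trans hc) (h.inner_self x) (h.kahlerL_add x r v)

theorem exists_orientation [IsManifold 𝓘(ℂ) ω S] [IsManifold 𝓘(ℝ, ℂ) ∞ S]
    (h : SatisfiesEvolution φ ψ A B)
    (hφ : ContMDiff 𝓘(ℝ, ℂ) 𝓘(ℝ, C3) ∞ φ) (hψ : ContMDiff 𝓘(ℝ, ℂ) 𝓘(ℝ, C3) ∞ ψ) :
    ∃ o : ∀ p : S × ℝ, IsImmersedAt (𝓘(ℝ, ℂ).prod 𝓘(ℝ, ℝ)) (ruledMap φ ψ) p →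
      Orientation ℝ (tangentPlane (𝓘(ℝ, ℂ).prod 𝓘(ℝ, ℝ)) (ruledMap φ ψ) p) (Fin 3),
    IsContinuousOrientation (𝓘(ℝ, ℂ).prod 𝓘(ℝ, ℝ)) (ruledMap φ ψ) o ∧
      ∀ p hp, IsCalibratedPlane (tangentPlane (𝓘(ℝ, ℂ).prod 𝓘(ℝ, ℝ)) (ruledMap φ ψ) p) (o p hp) := by
  have hE : ∀ p : S × ℝ, IsImmersedAt (𝓘(ℝ, ℂ).prod 𝓘(ℝ, ℝ)) (ruledMap φ ψ) p →
      ∃ o : Orientation ℝ (tangentPlane (𝓘(ℝ, ℂ).prod 𝓘(ℝ, ℝ)) (ruledMap φ ψ) p) (Fin 3),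
      IsCalibratedPlane (tangentPlane (𝓘(ℝ, ℂ).prod 𝓘(ℝ, ℝ)) (ruledMap φ ψ) p) o := by
    rintro ⟨x, r⟩ hp
    obtain ⟨E, h0, h1, h2⟩ := exists_basis_tangentPlane (h.hasMFDerivAt_fst x)
      (h.hasMFDerivAt_snd x) hp (one_ne_zero (α := ℂ))
    exact ⟨_, (h.isCalibratedPlane x r E h0 h1 h2).2⟩
  -- A pointwise choice suffices: a calibrated orientation is determined by the sign of Re Ω on a
  -- frame, so a continuous frame that is positive for Re Ω induces it.
  choose o ho using hE
  refine ⟨o, ?_, ho⟩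
  rintro ⟨x₀, r₀⟩ -
  set c := extChartAt 𝓘(ℝ, ℂ) x₀ with hc
  have hT : IsOpen c.target := isOpen_extChartAt_target x₀
  have hφT : ContinuousOn (fderiv ℝ (φ ∘ c.symm)) c.target :=
    (contDiffOn_fderiv_of_smooth hT (contDiffOn_comp_chart_symm x₀ hφ)).continuousOn
  have hψT : ContinuousOn (fderiv ℝ (ψ ∘ c.symm)) c.target :=
    (contDiffOn_fderiv_of_smooth hT (contDiffOn_comp_chart_symm x₀ hψ)).continuousOn
  have hcc : ContinuousOn (fun q : S × ℝ => c q.1) (c.source ×ˢ Set.univ) :=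
    (continuousOn_extChartAt x₀).comp continuousOn_fst fun q hq => hq.1
  have hmaps : Set.MapsTo (fun q : S × ℝ => c q.1) (c.source ×ˢ Set.univ) c.target :=
    fun q hq => c.map_source hq.1
  have hX : ∀ v : ℂ, ContinuousOn (fun q : S × ℝ => q.2 • fderiv ℝ (φ ∘ c.symm) (c q.1) v
      + fderiv ℝ (ψ ∘ c.symm) (c q.1) v) (c.source ×ˢ Set.univ) := fun v =>
    (continuousOn_snd.smul ((hφT.comp hcc hmaps).clm_apply continuousOn_const)).add
      ((hψT.comp hcc hmaps).clm_apply continuousOn_const)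
  refine ⟨c.source ×ˢ Set.univ, ((isOpen_extChartAt_source x₀).prod isOpen_univ).mem_nhds
    ⟨mem_extChartAt_source x₀, trivial⟩, ![fun q => φ q.1,
    fun q => q.2 • fderiv ℝ (φ ∘ c.symm) (c q.1) 1 + fderiv ℝ (ψ ∘ c.symm) (c q.1) 1,
    fun q => q.2 • fderiv ℝ (φ ∘ c.symm) (c q.1) Complex.I
      + fderiv ℝ (ψ ∘ c.symm) (c q.1) Complex.I], ?_, ?_⟩
  · intro i
    fin_cases i
    · exact (hφ.continuous.comp continuous_fst).continuousOn
    · exact hX 1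
    · exact hX Complex.I
  · rintro ⟨x, r⟩ ⟨hx, -⟩ hq
    have hy : c x ∈ c.target := c.map_source hx
    have hxy : c.symm (c x) = x := c.left_inv hx
    -- The coordinate fields at `x` are `a` and `I * a`, so the chart frame has the form required by
    -- `exists_basis_tangentPlane`.
    set a := chartSymmDeriv x₀ (c x) 1 with ha
    have hI : chartSymmDeriv x₀ (c x) Complex.I = Complex.I * a := by
      have := mfderiv_chart_symm_I_mul x₀ hy 1
      rw [mul_one] at this
      exact this
    have ha0 : a ≠ 0 := fun h0 => by
      have := mfderiv_chart_comp_mfderiv_chart_symm x₀ hy 1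
      rw [← ha, h0, map_zero] at this
      exact zero_ne_one this
    have hφx : fderiv ℝ (φ ∘ c.symm) (c x) = (A x).comp (chartSymmDeriv x₀ (c x)) := by
      have := (hasFDerivAt_comp_chart_symm x₀ hy (h.hasMFDerivAt_fst _)).fderiv
      rwa [hxy] at this
    have hψx : fderiv ℝ (ψ ∘ c.symm) (c x) = (B x).comp (chartSymmDeriv x₀ (c x)) := by
      have := (hasFDerivAt_comp_chart_symm x₀ hy (h.hasMFDerivAt_snd _)).fderiv
      rwa [hxy] at this
    obtain ⟨E, h0, h1, h2⟩ := exists_basis_tangentPlane (h.hasMFDerivAt_fst x)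
      (h.hasMFDerivAt_snd x) hq ha0
    refine ⟨E, ?_, (ho _ hq).orientation_eq E (h.isCalibratedPlane x r E h0 h1 h2).1⟩
    intro i
    fin_cases i
    · exact h0
    · change (E 1 : C3) = r • fderiv ℝ (φ ∘ c.symm) (c x) 1 + fderiv ℝ (ψ ∘ c.symm) (c x) 1
      rw [h1, hφx, hψx]; rfl
    · change (E 2 : C3) = r • fderiv ℝ (φ ∘ c.symm) (c x) Complex.I
        + fderiv ℝ (ψ ∘ c.symm) (c x) Complex.I
      rw [h2, hφx, hψx, ContinuousLinearMap.comp_apply, ContinuousLinearMap.comp_apply, hI]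

theorem isROrientedRuledSL [IsManifold 𝓘(ℂ) ω S] [IsManifold 𝓘(ℝ, ℂ) ∞ S]
    (h : SatisfiesEvolution φ ψ A B)
    (hφ : ContMDiff 𝓘(ℝ, ℂ) 𝓘(ℝ, C3) ∞ φ) (hψ : ContMDiff 𝓘(ℝ, ℂ) 𝓘(ℝ, C3) ∞ ψ) :
    IsROrientedRuledSL (𝓘(ℝ, ℂ).prod 𝓘(ℝ, ℝ)) 𝓘(ℝ, ℂ) (ruledMap φ ψ) Prod.fst φ where
  ruling :=
    { smooth_proj := contMDiff_fst
      continuous_dir := hφ.continuous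
      norm_dir := fun x => by rw [norm_eq_sqrt_real_inner, h.inner_self, Real.sqrt_one]
      fibre := fun x => by
        have hφx : φ x ≠ 0 := fun h0 => by simpa [h0] using h.inner_self x
        refine ⟨ψ x, ?_, ?_, ?_⟩
        · rintro ⟨y, r⟩ (rfl : y = x)
          exact ⟨r, add_comm _ _⟩
        · rintro ⟨y, r⟩ (rfl : y = x) ⟨z, s⟩ (rfl : z = y) hrs
          have h1 : r • φ z = s • φ z := add_right_cancel hrs
          rw [smul_left_injective ℝ hφx h1]
        · rintro _ ⟨r, rfl⟩
          exact ⟨(x, r), rfl, add_comm _ _⟩ }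
  specialLagrangian :=
    { smooth := (contMDiff_snd.smul (hφ.comp contMDiff_fst)).add (hψ.comp contMDiff_fst)
      dense_immersed := h.dense_immersed
      calibrated := h.exists_orientation hφ hψ }

end SatisfiesEvolution

end

/-! ### The displacement given by the Lie derivative and a primitive of β. -/

section

variable {S : Type*} [TopologicalSpace S] [ChartedSpace ℂ S] [IsManifold 𝓘(ℂ) ω S]
  [IsManifold 𝓘(ℝ, ℂ) ∞ S] {φ : S → C3} {ρ : S → ℝ} {w : ∀ x : S, TangentSpace 𝓘(ℂ) x}
  {b : S → C3}

theorem displacement_comp_chart_symm (hφ : ContMDiff 𝓘(ℝ, ℂ) 𝓘(ℝ, C3) ∞ φ) (x₀ : S) {y : ℂ}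
    (hy : y ∈ (extChartAt 𝓘(ℝ, ℂ) x₀).target) :
    ((fun x => lieDerivative w φ x + b x) ∘ (extChartAt 𝓘(ℝ, ℂ) x₀).symm) y
      = fderiv ℝ (φ ∘ (extChartAt 𝓘(ℝ, ℂ) x₀).symm) y (localField w x₀ y)
        + (b ∘ (extChartAt 𝓘(ℝ, ℂ) x₀).symm) y := by
  have h : chartSymmDeriv x₀ y (localField w x₀ y) = w ((extChartAt 𝓘(ℝ, ℂ) x₀).symm y) :=
    mfderiv_chart_symm_comp_mfderiv_chart x₀ hy _
  rw [fderiv_comp_chart_symm x₀ hy (hφ.mdifferentiable (by simp) _), h]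
  rfl

theorem hasFDerivAt_primitive_comp_chart_symm (hφ : ContMDiff 𝓘(ℝ, ℂ) 𝓘(ℝ, C3) ∞ φ)
    (hρ : ContMDiff 𝓘(ℝ, ℂ) 𝓘(ℝ, ℝ) ∞ ρ)
    (hb : ∀ x, HasMFDerivAt 𝓘(ℝ, ℂ) 𝓘(ℝ, C3) b x (bryantForm φ ρ x)) (x₀ : S) {y : ℂ}
    (hy : y ∈ (extChartAt 𝓘(ℝ, ℂ) x₀).target) :
    HasFDerivAt (b ∘ (extChartAt 𝓘(ℝ, ℂ) x₀).symm)
      (localBryantForm (φ ∘ (extChartAt 𝓘(ℝ, ℂ) x₀).symm)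
        (ρ ∘ (extChartAt 𝓘(ℝ, ℂ) x₀).symm) y) y := by
  rw [← localForm_bryantForm hφ hρ x₀ hy]
  exact hasFDerivAt_comp_chart_symm x₀ hy (hb _)

theorem contMDiff_displacement (hφ : ContMDiff 𝓘(ℝ, ℂ) 𝓘(ℝ, C3) ∞ φ)
    (hρ : ContMDiff 𝓘(ℝ, ℂ) 𝓘(ℝ, ℝ) ∞ ρ) (hw : IsHolomorphicVectorField w)
    (hb : ∀ x, HasMFDerivAt 𝓘(ℝ, ℂ) 𝓘(ℝ, C3) b x (bryantForm φ ρ x)) :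
    ContMDiff 𝓘(ℝ, ℂ) 𝓘(ℝ, C3) ∞ (fun x => lieDerivative w φ x + b x) := by
  refine contMDiff_of_contDiffOn_comp_chart_symm fun x₀ => ?_
  have hT : IsOpen (extChartAt 𝓘(ℝ, ℂ) x₀).target := isOpen_extChartAt_target x₀
  have h1 := contDiffOn_comp_chart_symm x₀ hφ
  have h2 := contDiffOn_comp_chart_symm x₀ hρ
  -- Complex differentiability on an open set already gives smoothness.
  have hW : ContDiffOn ℝ ∞ (localField w x₀) (extChartAt 𝓘(ℝ, ℂ) x₀).target :=
    (DifferentiableOn.contDiffOn (n := ∞) (fun y hy =>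
      (hw.differentiableAt_localField x₀ hy).differentiableWithinAt) hT).restrict_scalars ℝ
  have hbT : ContDiffOn ℝ ∞ (b ∘ (extChartAt 𝓘(ℝ, ℂ) x₀).symm) (extChartAt 𝓘(ℝ, ℂ) x₀).target := by
    have hd := fun y (hy : y ∈ (extChartAt 𝓘(ℝ, ℂ) x₀).target) =>
      hasFDerivAt_primitive_comp_chart_symm hφ hρ hb x₀ hy
    -- `b` is given only as differentiable; it is smooth because its derivative is the smooth form
    -- β.
    rw [contDiffOn_infty_iff_fderiv_of_isOpen hT]
    exact ⟨fun y hy => (hd y hy).differentiableAt.differentiableWithinAt,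
      (contDiffOn_localBryantForm hT h1 h2).congr fun y hy => (hd y hy).fderiv⟩
  exact (((contDiffOn_fderiv_of_smooth hT h1).clm_apply hW).add hbT).congr fun y hy =>
    displacement_comp_chart_symm hφ x₀ hy

theorem satisfiesEvolution (hφ : IsROrientedSLCone φ) (hJ : IsInducedComplexStructure φ)
    (hρ : ContMDiff 𝓘(ℝ, ℂ) 𝓘(ℝ, ℝ) ∞ ρ) (hw : IsHolomorphicVectorField w)
    (hb : ∀ x, HasMFDerivAt 𝓘(ℝ, ℂ) 𝓘(ℝ, C3) b x (bryantForm φ ρ x)) :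
    SatisfiesEvolution φ (fun x => lieDerivative w φ x + b x) (fun x => diff φ x)
      (fun x => diff (fun x => lieDerivative w φ x + b x) x) := by
  have hG := (contMDiff_displacement hφ.smooth hρ hw hb).mdifferentiable (by simp)
  -- The equations are pointwise, so each `x` is treated at the centre of its own chart, where
  -- `diff` is the ordinary derivative of the representative.
  have key : ∀ x, (∀ v : ℂ, kahlerL (φ x)
      ((diff (fun x => lieDerivative w φ x + b x) x : ℂ →L[ℝ] C3) v) = 0) ∧ ∀ v : ℂ, ∃ c : ℝ,
      (diff (fun x => lieDerivative w φ x + b x) x : ℂ →L[ℝ] C3) (Complex.I * v)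
        = cross (φ x) ((diff (fun x => lieDerivative w φ x + b x) x : ℂ →L[ℝ] C3) v)
          + c • φ x := by
    intro x
    have hcx := mem_extChartAt_target (I := 𝓘(ℝ, ℂ)) x
    have hD : HasFDerivAt ((fun x => lieDerivative w φ x + b x) ∘ (extChartAt 𝓘(ℝ, ℂ) x).symm)
        (diff (fun x => lieDerivative w φ x + b x) x) (extChartAt 𝓘(ℝ, ℂ) x x) := by
      rw [diff_eq_fderiv (hG x)]
      exact ((contDiffOn_comp_chart_symm x (contMDiff_displacement hφ.smooth hρ hw hb)).contDiffAt
        (extChartAt_target_mem_nhds x)).differentiableAt (by simp) |>.hasFDerivAt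
    have hD' := hD.congr_of_eventuallyEq (f₁ := fun y =>
      fderiv ℝ (φ ∘ (extChartAt 𝓘(ℝ, ℂ) x).symm) y (localField w x y)
        + (b ∘ (extChartAt 𝓘(ℝ, ℂ) x).symm) y) (by
      filter_upwards [extChartAt_target_mem_nhds (I := 𝓘(ℝ, ℂ)) x] with y hy
      exact (displacement_comp_chart_symm hφ.smooth x hy).symm)
    have h1 := (hφ.isLocalCone hJ x).evolution hcx (hw.differentiableAt_localField x hcx)
      (hasFDerivAt_primitive_comp_chart_symm hφ.smooth hρ hb x hcx) hD'
    have h2 : (φ ∘ (extChartAt 𝓘(ℝ, ℂ) x).symm) (extChartAt 𝓘(ℝ, ℂ) x x) = φ x :=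
      congrArg φ (extChartAt_to_inv x)
    rw [h2] at h1
    exact h1
  exact
    { hasMFDerivAt_fst := fun x => (hφ.mdifferentiableAt x).hasMFDerivAt
      hasMFDerivAt_snd := fun x => (hG x).hasMFDerivAt
      inner_self := hφ.inner_self
      inner_fst := hφ.inner_diff
      ne_zero := fun x => hφ.diff_ne_zero x (one_ne_zero (α := ℂ))
      cross_fst := fun x v => (hφ.cross_diff hJ x v).1
      kahlerL_snd := fun x => (key x).1
      cross_snd := fun x => (key x).2 }

end

end RuledSL

end

theorem theorem6p2 {S : Type*} [TopologicalSpace S] [T2Space S] [ChartedSpace ℂ S]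
    [IsManifold 𝓘(ℂ) ω S] [SimplyConnectedSpace S]
    (φ : S → RuledSL.C3)
    (hφ : RuledSL.IsROrientedSLCone φ)
    (hJ : RuledSL.IsInducedComplexStructure φ)
    (w : ∀ x : S, TangentSpace 𝓘(ℂ) x)
    (hw : RuledSL.IsHolomorphicVectorField w)
    (ρ : S → ℝ) (hρ : ContMDiff 𝓘(ℝ, ℂ) 𝓘(ℝ, ℝ) ∞ ρ)
    (hρeq : ∀ x, RuledSL.starDStarD φ ρ x + 2 * ρ x = 0) :
    (∀ x u v, RuledSL.extD (RuledSL.bryantForm φ ρ) x u v = 0) ∧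
    (∃ b : S → RuledSL.C3, ∀ x,
      HasMFDerivAt 𝓘(ℝ, ℂ) 𝓘(ℝ, RuledSL.C3) b x (RuledSL.bryantForm φ ρ x)) ∧
    ∀ b : S → RuledSL.C3,
      (∀ x, HasMFDerivAt 𝓘(ℝ, ℂ) 𝓘(ℝ, RuledSL.C3) b x (RuledSL.bryantForm φ ρ x)) →
      RuledSL.IsROrientedRuledSL (𝓘(ℝ, ℂ).prod 𝓘(ℝ, ℝ)) 𝓘(ℝ, ℂ)
        (RuledSL.ruledMap φ (fun σ => RuledSL.lieDerivative w φ σ + b σ)) Prod.fst φ := by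
  have _ : IsManifold 𝓘(ℝ, ℂ) ∞ S := RuledSL.isManifold_real S
  refine ⟨fun x u v => ?_, ?_, fun b hb => ?_⟩
  · exact (RuledSL.extD_eq _ x u v).trans (sub_eq_zero.2
      (RuledSL.localForm_bryantForm_closed hφ hJ hρ hρeq x (mem_extChartAt_target x) u v))
  · refine RuledSL.exists_primitive _ (fun x₀ => ?_) fun x₀ y hy =>
      RuledSL.localForm_bryantForm_closed hφ hJ hρ hρeq x₀ hy
    exact (((RuledSL.contDiffOn_localBryantForm (isOpen_extChartAt_target x₀)
      (RuledSL.contDiffOn_comp_chart_symm x₀ hφ.smooth)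
      (RuledSL.contDiffOn_comp_chart_symm x₀ hρ)).differentiableOn (by simp))).congr
      fun y hy => RuledSL.localForm_bryantForm hφ.smooth hρ x₀ hy
  · exact (RuledSL.satisfiesEvolution hφ hJ hρ hw hb).isROrientedRuledSL hφ.smooth
      (RuledSL.contMDiff_displacement hφ.smooth hρ hw hb)
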